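/- Let $K$ be a field. A function $H:\mathbb Z_{\ge 0}\to\mathbb Z_{\ge 0}$ is an *O-sequence* if it is the Hilbert function $t\mapsto\dim_K R_t-\dim_K I_t$ of $R/I$ for some polynomial ring $R=K[x_1,\dots,x_p]$ with the standard grading and some homogeneous ideal $I\subseteq R$. A *finite O-sequence* is a tuple $(a_0,\dots,a_s)$ with $a_s\ne 0$ such that $(a_0,\dots,a_s,0,0,\dots)$ is an O-sequence; its *multiplicity* is $\sum_i a_i$. For $d\ge 1$ let $O_d$ be the number of finite O-sequences of multiplicity $d$, and let $A_d$ be the number of those whose last value $a_s$ is greater than $1$. For positive integers $a,t$ with binomial expansion $a=\binom{k(t)}{t}+\binom{k(t-1)}{t-1}+\dots+\binom{k(j)}{j}$, $k(t)>k(t-1)>\dots>k(j)\ge j\ge 1$, put $a^{\langle t\rangle}=\binom{k(t)+1}{t+1}+\binom{k(t-1)+1}{t}+\dots+\binom{k(j)+1}{j+1}$. Consider the following algorithm, with input an integer $D\ge 4$. 1. Initialise the lists $O:=[1,1,2,3]$ and $A:=[0,0,1,1]$ (indexed from $1$), and the lists of sequences $B_{2}:=[(1,2)]$ and $B_{1}:=[(1,3)]$.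 2. For $d=5,\dots,D$: - let $B$ be the list of the following sequences: $(a_0,\dots,a_s,2)$ for each $(a_0,\dots,a_s)$ in $B_{2}$, and $(a_0,\dots,a_{s-1},a_s+1)$ for each $(a_0,\dots,a_s)$ in $B_{1}$ for which this increment is possible, i.e. $s=1$, or $s\ge 2$ and $a_s+1\le a_{s-1}^{\langle s-1\rangle}$; - append the length of $B$ to $A$, and then append $A[d]+O[d-1]$ to $O$; - replace $B_{2}$ by $B_{1}$, and $B_{1}$ by $B$. 3. Return $O$. **Proposition.** For every integer $D\ge 4$, the numbers $O_1,\dots,O_D$ are finite and the algorithm returns the list $[O_1,O_2,\dots,O_D]$. Moreover, when it stops, the list $A$ is $[A_1,\dots,A_D]$, and $B_{1}$ and $B_{2}$ list, without repetition, exactly the finite O-sequences with last value greater than $1$ of multiplicity $D$ and $D-1$, respectively. -/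

import Mathlib

namespace OSeq

attribute [local instance] MvPolynomial.gradedAlgebra

/-- The degree `t` component `I_t = I ∩ R_t` of an ideal `I` of `R = K[x_1, …, x_p]`. -/
noncomputable def idealDegreePart {K : Type*} [Field K] {p : ℕ} (I : Ideal (MvPolynomial (Fin p) K)) (t : ℕ) :
    Submodule K (MvPolynomial (Fin p) K) :=
  I.restrictScalars K ⊓ MvPolynomial.homogeneousSubmodule (Fin p) K t

/-- The Hilbert function `t ↦ dim_K R_t - dim_K I_t` of `R / I`, where `R = K[x_1, …, x_p]`.
Both spaces are finite-dimensional and `I_t ≤ R_t`, so the subtraction is never truncated. -/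
noncomputable def hilbertFunction {K : Type*} [Field K] {p : ℕ}
    (I : Ideal (MvPolynomial (Fin p) K)) (t : ℕ) : ℕ :=
  Module.finrank K (MvPolynomial.homogeneousSubmodule (Fin p) K t) -
    Module.finrank K (idealDegreePart I t)

/-- A numerical function is an O-sequence (over `K`) if it is the Hilbert function of `R / I` for
some polynomial ring `R` in finitely many variables over `K` and some homogeneous ideal `I`. -/
def IsOSequence (K : Type*) [Field K] (H : ℕ → ℕ) : Prop :=
  ∃ (p : ℕ) (I : Ideal (MvPolynomial (Fin p) K)),
    I.IsHomogeneous (MvPolynomial.homogeneousSubmodule (Fin p) K) ∧ H = hilbertFunction I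

/-- A finite O-sequence `(a_0, …, a_s)` with `a_s ≠ 0`: the list of values, followed by zeros
in all degrees `> s`, is an O-sequence. (The quotient is then finite-dimensional over `K`, that
is, Artinian.) -/
def IsFiniteOSequence (K : Type*) [Field K] (l : List ℕ) : Prop :=
  l ≠ [] ∧ l.getLastD 0 ≠ 0 ∧ IsOSequence K (fun t => l.getD t 0)

/-- The set of finite O-sequences of multiplicity `d`, i.e. with `∑ a_i = d`. -/
def finiteOSequences (K : Type*) [Field K] (d : ℕ) : Set (List ℕ) :=
  {l | IsFiniteOSequence K l ∧ l.sum = d}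

/-- The set of finite O-sequences of multiplicity `d` whose last non-zero value exceeds `1`. -/
def bigLastOSequences (K : Type*) [Field K] (d : ℕ) : Set (List ℕ) :=
  {l | l ∈ finiteOSequences K d ∧ 1 < l.getLastD 0}

/-- `O_d`. -/
noncomputable def numO (K : Type*) [Field K] (d : ℕ) : ℕ := (finiteOSequences K d).ncard

/-- `A_d`. -/
noncomputable def numA (K : Type*) [Field K] (d : ℕ) : ℕ := (bigLastOSequences K d).ncard

/-- `macaulayBound t a` is `a^{⟨t⟩}` for `t ≥ 1`: the binomial expansion
`a = C(k(t), t) + C(k(t-1), t-1) + ⋯ + C(k(j), j)` is found greedily, `k(t)` being the largest `k`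
with `C(k, t) ≤ a` (necessarily `k ≤ a + t - 1`), and each `C(k(i), i)` is replaced by
`C(k(i) + 1, i + 1)`. -/
def macaulayBound : ℕ → ℕ → ℕ
  | 0, _ => 0
  | t + 1, a =>
    if a = 0 then 0
    else
      let k := Nat.findGreatest (fun k => k.choose (t + 1) ≤ a) (a + t)
      (k + 1).choose (t + 2) + macaulayBound t (a - k.choose (t + 1))

/-- The test whether the last value of `(a_0, …, a_s)` may be increased by `1`: for `s ≥ 2` it is
`a_s + 1 ≤ a_{s-1}^{⟨s-1⟩}`; the value `a_1` is not bounded, and `a_0` cannot be increased. -/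
def canIncrementLast (l : List ℕ) : Bool :=
  let s := l.length - 1
  if s = 0 then false
  else if s = 1 then true
  else decide (l.getD s 0 + 1 ≤ macaulayBound (s - 1) (l.getD (s - 1) 0))

/-- `(a_0, …, a_s) ↦ (a_0, …, a_s + 1)`. -/
def incrementLast (l : List ℕ) : List ℕ := l.dropLast ++ [l.getLastD 0 + 1]

/-- `(a_0, …, a_s) ↦ (a_0, …, a_s, 2)`. -/
def attachTwo (l : List ℕ) : List ℕ := l ++ [2]

/-- The variables of the algorithm: the lists `O` and `A` of integers, three lists `B` of sequences,
and the three indices `h₂, h₁, h` into `B`. -/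
structure AlgState where
  O : List ℕ
  A : List ℕ
  B : Fin 3 → List (List ℕ)
  h₂ : Fin 3
  h₁ : Fin 3
  h : Fin 3

/-- The initialisation. -/
def initState : AlgState where
  O := [1, 1, 2, 3]
  A := [0, 0, 1, 1]
  B := ![[[1, 2]], [[1, 3]], []]
  h₂ := 0
  h₁ := 1
  h := 2

/-- The body of the loop for the value `d` of the loop variable. The lists `O` and `A` are indexed
from `1` in the algorithm, so that `A[d]` is the entry at position `d - 1` and `O[d-1]` the one at
position `d - 2` of the Lean lists. -/
def loopBody (S : AlgState) (d : ℕ) : AlgState :=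
  let Bh := (S.B S.h₂).map attachTwo ++ ((S.B S.h₁).filter canIncrementLast).map incrementLast
  let A' := S.A ++ [Bh.length]
  let O' := S.O ++ [A'.getD (d - 1) 0 + S.O.getD (d - 2) 0]
  { O := O'
    A := A'
    B := Function.update S.B S.h Bh
    h₂ := S.h₁
    h₁ := S.h
    h := S.h₂ }

/-- The state of the algorithm after the loop `for d = 5 to D`. -/
def finalState (D : ℕ) : AlgState := (List.range' 5 (D - 4)).foldl loopBody initState

/-- The output of the algorithm on input `D`. -/
def algorithm (D : ℕ) : List ℕ := (finalState D).O

end OSeq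

/-! By Macaulay's theorem (`isOSequence_iff`) a nonzero H of finite support is an O-sequence iff
H(0) = 1 and H(t+1) ≤ H(t)^⟨t⟩ for t ≥ 1; the field plays no role. So an admissible list may be
extended by x ≠ 0 subject only to one inequality with its last value (`isFiniteOSequence_concat`).

As 1^⟨t⟩ = 1 and a ≤ a^⟨t⟩, a sequence with last value > 1 and multiplicity at least 4 has one
predecessor: delete a last value 2, or lower a larger last value by one
(`mem_bigLastOSequences_add_two`). Deleting a last value 1 gives O_d = A_d + O_{d-1} (`numO_succ`).
The algorithm runs these recursions.

Necessity in Macaulay's theorem: the Hilbert function counts standard monomials, which are closed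
under division, so it suffices to bound a set N of monomials of one degree by its shadow
(`card_le_macaulayBound_shadow`). Compression along two-variable lines keeps |N|, does not enlarge
the shadow and ends in a stable set. For stable sets Macaulay's bound and Green's restriction bound
are proved together, each degree of one feeding the other, through two inequalities between a^⟨t⟩
and a_⟨t⟩.

Sufficiency: initial segments of monomials of sizes H(t) are closed under division
(`shadow_segment_subset`), and the remaining monomials span an ideal. -/

namespace OSeq

/-! ### Arithmetic of binomial expansions -/

/-- Greedy step of the binomial expansion: every `x` is `C(k, t+1) + r` with `r < C(k, t)`. -/
theorem exists_choose_add (t x : ℕ) :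
    ∃ k r, t ≤ k ∧ x = k.choose (t + 1) + r ∧ r < k.choose t := by
  induction x with
  | zero => exact ⟨t, 0, le_rfl, by simp, by simp⟩
  | succ x ih =>
    obtain ⟨k, r, hk, hx, hr⟩ := ih
    by_cases h : r + 1 < k.choose t
    · exact ⟨k, r + 1, hk, by omega, h⟩
    · refine ⟨k + 1, 0, by omega, ?_, Nat.choose_pos (by omega)⟩
      rw [Nat.choose_succ_succ']
      omega

theorem findGreatest_choose {t k r : ℕ} (hr : r < k.choose t)
    (hx : k.choose (t + 1) + r ≠ 0) :
    Nat.findGreatest (fun j => j.choose (t + 1) ≤ k.choose (t + 1) + r)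
      (k.choose (t + 1) + r + t) = k := by
  have hlt : k.choose (t + 1) + r < (k + 1).choose (t + 1) := by
    rw [Nat.choose_succ_succ']; omega
  have hk : t + 1 ≤ k := by
    by_contra hk
    rw [Nat.choose_eq_zero_of_lt (by omega)] at hlt hx
    have h1 : k.choose t ≤ 1 := by
      rcases Nat.lt_or_ge k t with h | h
      · rw [Nat.choose_eq_zero_of_lt h]; exact zero_le_one
      · rw [show k = t by omega, Nat.choose_self]
    omega
  rw [Nat.findGreatest_eq_iff]
  refine ⟨?_, fun _ => by omega, fun n hn _ h => ?_⟩
  -- The search range reaches k: from the value 1 at k = t + 1, the binomial grows by at least one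
  -- per step.
  · have : k ≤ k.choose (t + 1) + t := by
      clear hr hx hlt
      induction k, hk using Nat.le_induction with
      | base => simp
      | succ k hk ih =>
        have := Nat.choose_pos (n := k) (k := t) (by omega)
        rw [Nat.choose_succ_succ']; omega
    omega
  · exact absurd (Nat.choose_le_choose (t + 1) (show k + 1 ≤ n by omega)) (by omega)

/-- The lower companion `a_{⟨t⟩} = C(k(t)-1, t) + ⋯ + C(k(j)-1, j)` of `macaulayBound`, which bounds
the Hilbert function of a hyperplane section. -/
def greenBound : ℕ → ℕ → ℕ
  | 0, _ => 0
  | t + 1, a =>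
    if a = 0 then 0
    else
      let k := Nat.findGreatest (fun k => k.choose (t + 1) ≤ a) (a + t)
      (k - 1).choose (t + 1) + greenBound t (a - k.choose (t + 1))

theorem macaulayBound_zero_right (t : ℕ) : macaulayBound t 0 = 0 := by
  cases t <;> simp [macaulayBound]

theorem greenBound_zero_right (t : ℕ) : greenBound t 0 = 0 := by
  cases t <;> simp [greenBound]

theorem choose_add_eq_zero {t k r : ℕ} (hk : t ≤ k) (hx : k.choose (t + 1) + r = 0) :
    k = t ∧ r = 0 := by
  refine ⟨?_, by omega⟩
  by_contra h
  have := Nat.choose_pos (n := k) (k := t + 1) (by omega)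
  omega

/-- With `exists_choose_add` this replaces the greedy search. The case k = t forces r = 0 and
represents the number 0, so later inductions can treat 0 as an expansion too. -/
theorem macaulayBound_choose_add {t k r : ℕ} (hk : t ≤ k) (hr : r < k.choose t) :
    macaulayBound (t + 1) (k.choose (t + 1) + r) =
      (k + 1).choose (t + 2) + macaulayBound t r := by
  by_cases hx : k.choose (t + 1) + r = 0
  · obtain ⟨rfl, rfl⟩ := choose_add_eq_zero hk hx
    simp [macaulayBound_zero_right]
  · rw [macaulayBound, if_neg hx]
    simp only [findGreatest_choose hr hx, Nat.add_sub_cancel_left]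

theorem greenBound_choose_add {t k r : ℕ} (hk : t ≤ k) (hr : r < k.choose t) :
    greenBound (t + 1) (k.choose (t + 1) + r) =
      (k - 1).choose (t + 1) + greenBound t r := by
  by_cases hx : k.choose (t + 1) + r = 0
  · obtain ⟨rfl, rfl⟩ := choose_add_eq_zero hk hx
    rw [hx, greenBound_zero_right, greenBound_zero_right, Nat.choose_eq_zero_of_lt (by omega)]
  · rw [greenBound, if_neg hx]
    simp only [findGreatest_choose hr hx, Nat.add_sub_cancel_left]

theorem le_of_choose_add_le {t k l r s : ℕ} (hs : s < l.choose t)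
    (h : k.choose (t + 1) + r ≤ l.choose (t + 1) + s) : k ≤ l := by
  by_contra hkl
  have h1 := Nat.choose_le_choose (t + 1) (show l + 1 ≤ k by omega)
  rw [Nat.choose_succ_succ'] at h1
  omega

/-- Ensures that raising an expansion gives an expansion again, with leading index k + 1, so that
`le_of_choose_add_le` applies to it. -/
theorem macaulayBound_lt {t k r : ℕ} (hk : t ≤ k) (hr : r < k.choose t) :
    macaulayBound t r < (k + 1).choose (t + 1) := by
  induction t generalizing k r with
  | zero => simp [macaulayBound]
  | succ t ih =>
    obtain ⟨l, s, hl, rfl, hs⟩ := exists_choose_add t r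
    rw [macaulayBound_choose_add hl hs]
    have h1 := ih hl hs
    have hlk : l < k := by
      by_contra h
      exact absurd (Nat.choose_le_choose (t + 1) (show k ≤ l by omega)) (by omega)
    have h2 := Nat.choose_le_choose (t + 1 + 1) (show l + 1 + 1 ≤ k + 1 by omega)
    rw [Nat.choose_succ_succ' (l + 1)] at h2
    simp only [Nat.add_assoc, Nat.reduceAdd] at *
    omega

theorem greenBound_lt {t k r : ℕ} (hk : t ≤ k) (hr : r < (k + 1).choose t) :
    greenBound t r < k.choose t := by
  induction t generalizing k r with
  | zero => simp [greenBound]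
  | succ t ih =>
    obtain ⟨l, s, hl, rfl, hs⟩ := exists_choose_add t r
    have hlk : l ≤ k := by
      by_contra h
      exact absurd (Nat.choose_le_choose (t + 1) (show k + 1 ≤ l by omega)) (by omega)
    rcases hl.eq_or_lt with rfl | hl'
    · have hs0 : s = 0 := by simpa using hs
      subst hs0
      rw [Nat.choose_succ_self, greenBound_zero_right]
      exact Nat.choose_pos hk
    · obtain ⟨l, rfl⟩ : ∃ m, l = m + 1 := ⟨l - 1, by omega⟩
      rw [greenBound_choose_add hl hs]
      have h1 := ih (show t ≤ l by omega) hs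
      have h2 := Nat.choose_le_choose (t + 1) hlk
      rw [Nat.choose_succ_succ' l] at h2
      simp only [Nat.add_sub_cancel] at *
      omega

/-- Compare leading indices: if they agree, the remainders decide; otherwise `macaulayBound_lt` and
Pascal's rule do. Degree 0 is left out because the bound is constant there. -/
theorem macaulayBound_strictMono (t : ℕ) : StrictMono (macaulayBound (t + 1)) := by
  induction t with
  | zero =>
    intro x y h
    obtain ⟨k, r, hk, rfl, hr⟩ := exists_choose_add 0 x
    obtain ⟨l, s, hl, rfl, hs⟩ := exists_choose_add 0 y
    rw [macaulayBound_choose_add hk hr, macaulayBound_choose_add hl hs]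
    simp only [Nat.choose_zero_right, Nat.lt_one_iff] at hr hs
    subst hr hs
    simp only [zero_add, Nat.choose_one_right, add_zero] at h
    have h2 := Nat.choose_le_choose 2 (show k + 1 + 1 ≤ l + 1 by omega)
    rw [Nat.choose_succ_succ' (k + 1)] at h2
    simp [macaulayBound] at *
    omega
  | succ t ih =>
    intro x y h
    obtain ⟨k, r, hk, rfl, hr⟩ := exists_choose_add (t + 1) x
    obtain ⟨l, s, hl, rfl, hs⟩ := exists_choose_add (t + 1) y
    rw [macaulayBound_choose_add hk hr, macaulayBound_choose_add hl hs]
    have hkl := le_of_choose_add_le hs h.le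
    rcases hkl.eq_or_lt with rfl | hkl
    · have := ih (show r < s by omega)
      omega
    · have h1 := macaulayBound_lt hk hr
      have h2 := Nat.choose_le_choose (t + 1 + 2) (show k + 1 + 1 ≤ l + 1 by omega)
      rw [Nat.choose_succ_succ' (k + 1)] at h2
      simp only [Nat.add_assoc, Nat.reduceAdd] at *
      omega

theorem macaulayBound_mono (t : ℕ) : Monotone (macaulayBound t) := by
  cases t with
  | zero => intro x y _; simp [macaulayBound]
  | succ t => exact (macaulayBound_strictMono t).monotone

/-- Pascal's rule term by term: C(k, i) is lowered to C(k-1, i), raised to C(k, i+1), and C(k, i+1)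
+ C(k, i) = C(k+1, i+1). By `greenBound_lt` the lowered expansion is still greedy. -/
theorem macaulayBound_greenBound (t x : ℕ) :
    macaulayBound (t + 1) (greenBound (t + 1) x) + x = macaulayBound (t + 1) x := by
  induction t generalizing x with
  | zero =>
    obtain ⟨k, r, hk, rfl, hr⟩ := exists_choose_add 0 x
    have hr0 : r = 0 := by simpa using hr
    subst hr0
    rcases k with _ | k
    · simp [greenBound_zero_right, macaulayBound_zero_right]
    · rw [greenBound_choose_add hk hr, greenBound_zero_right, Nat.add_sub_cancel,
        macaulayBound_choose_add (by omega) (by simp), macaulayBound_choose_add hk hr,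
        Nat.choose_succ_succ' (k + 1)]
      simp only [Nat.add_assoc, Nat.reduceAdd]
      omega
  | succ t ih =>
    obtain ⟨k, r, hk, rfl, hr⟩ := exists_choose_add (t + 1) x
    rcases hk.eq_or_lt with rfl | hk'
    · have hr0 : r = 0 := by simpa using hr
      subst hr0
      simp [greenBound_zero_right, macaulayBound_zero_right]
    · obtain ⟨k, rfl⟩ : ∃ m, k = m + 1 := ⟨k - 1, by omega⟩
      have h1 := greenBound_lt (show t + 1 ≤ k by omega) hr
      rw [greenBound_choose_add hk hr, Nat.add_sub_cancel,
        macaulayBound_choose_add (by omega) h1, macaulayBound_choose_add hk hr, ← ih r,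
        Nat.choose_succ_succ' (k + 1)]
      simp only [Nat.add_assoc, Nat.reduceAdd]
      omega

theorem greenBound_one (x : ℕ) : greenBound 1 x = x - 1 := by
  obtain ⟨k, r, hk, rfl, hr⟩ := exists_choose_add 0 x
  have hr0 : r = 0 := by simpa using hr
  subst hr0
  rw [greenBound_choose_add hk hr]
  simp [greenBound]

/-- Lowering C(l, i) to C(l-1, i) loses C(l-1, i-1); by Pascal's rule these losses add up to at most
one binomial. -/
theorem le_greenBound_add_choose {t k r : ℕ} (hr : r < (k + 1).choose (t + 1)) :
    r ≤ greenBound (t + 1) r + k.choose t := by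
  induction t generalizing k r with
  | zero => rw [greenBound_one]; simp; omega
  | succ t ih =>
    obtain ⟨l, s, hl, rfl, hs⟩ := exists_choose_add (t + 1) r
    have hlk : l ≤ k := by
      by_contra h
      exact absurd (Nat.choose_le_choose (t + 1 + 1) (show k + 1 ≤ l by omega)) (by omega)
    obtain ⟨l, rfl⟩ : ∃ m, l = m + 1 := ⟨l - 1, by omega⟩
    rw [greenBound_choose_add hl hs]
    have h1 := ih hs
    have h2 := Nat.choose_le_choose (t + 1) hlk
    rw [Nat.choose_succ_succ' l] at h2 ⊢
    simp only [Nat.add_assoc, Nat.reduceAdd, Nat.add_sub_cancel] at *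
    omega

/-- If `x ≤ u^{⟨t⟩}`, then `x - u ≤ x_{⟨t+1⟩}`. -/
theorem le_greenBound_add {t x u : ℕ} (h : x ≤ macaulayBound (t + 1) u) :
    x ≤ greenBound (t + 2) x + u := by
  induction t generalizing x u with
  | zero =>
    obtain ⟨k, r, hk, rfl, hr⟩ := exists_choose_add 1 x
    obtain ⟨l, v, hl, rfl, hv⟩ := exists_choose_add 0 u
    rw [macaulayBound_choose_add hl hv] at h
    have hkl : k ≤ l + 1 :=
      le_of_choose_add_le (t := 1) (s := 0) (by simp) (by simpa [macaulayBound] using h)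
    obtain ⟨k, rfl⟩ : ∃ m, k = m + 1 := ⟨k - 1, by omega⟩
    rw [greenBound_choose_add hk hr, greenBound_one]
    rw [Nat.choose_succ_succ']
    simp [macaulayBound] at h ⊢
    rcases (show k ≤ l by omega).eq_or_lt with rfl | hlt
    · simp at h; omega
    · omega
  | succ t ih =>
    obtain ⟨k, r, hk, rfl, hr⟩ := exists_choose_add (t + 2) x
    obtain ⟨l, v, hl, rfl, hv⟩ := exists_choose_add (t + 1) u
    rw [macaulayBound_choose_add hl hv] at h
    have hkl : k ≤ l + 1 := le_of_choose_add_le (macaulayBound_lt hl hv) h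
    obtain ⟨k, rfl⟩ : ∃ m, k = m + 1 := ⟨k - 1, by omega⟩
    rw [greenBound_choose_add hk hr, Nat.choose_succ_succ']
    simp only [Nat.add_assoc, Nat.reduceAdd, Nat.add_sub_cancel] at h ⊢
    -- The leading term of x loses C(k, t+2). For k = l this is the leading term of u, leaving the
    -- remainders; for k < l the total loss is at most C(k, t+2) + C(k, t+1) = C(k+1, t+2) ≤ C(l,
    -- t+2).
    rcases (show k ≤ l by omega).eq_or_lt with rfl | hlt
    · have := ih (x := r) (u := v) (by omega)
      omega
    · have h1 := le_greenBound_add_choose hr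
      have h2 := Nat.choose_le_choose (t + 2) (show k + 1 ≤ l by omega)
      rw [Nat.choose_succ_succ'] at h2
      simp only [Nat.add_assoc, Nat.reduceAdd] at *
      omega

end OSeq

/-! ### Stable sets of monomials: the bounds of Green and Macaulay -/

namespace OSeq

open Finsupp (single)

/-- A finite set of monomials in the variables `y_p, y_{p+1}, …` (given by their exponents) is stable
if it is closed under replacing a variable by one of smaller index. -/
structure IsStable (p : ℕ) (N : Finset (ℕ →₀ ℕ)) : Prop where
  eq_zero_of_lt : ∀ m ∈ N, ∀ i < p, m i = 0
  exchange : ∀ (m : ℕ →₀ ℕ) (i j : ℕ), p ≤ i → i < j → m + single j 1 ∈ N → m + single i 1 ∈ N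

/-- The monomials `m` with `y_p m ∈ N`. -/
noncomputable def colon (p : ℕ) (N : Finset (ℕ →₀ ℕ)) : Finset (ℕ →₀ ℕ) :=
  N.preimage (· + single p 1) (add_left_injective _).injOn

theorem mem_colon {p : ℕ} {N : Finset (ℕ →₀ ℕ)} {m : ℕ →₀ ℕ} :
    m ∈ colon p N ↔ m + single p 1 ∈ N := by
  simp [colon]

/-- The members of `N` not divisible by `y_p`. -/
def freePart (p : ℕ) (N : Finset (ℕ →₀ ℕ)) : Finset (ℕ →₀ ℕ) := N.filter (fun m => m p = 0)

theorem mem_freePart {p : ℕ} {N : Finset (ℕ →₀ ℕ)} {m : ℕ →₀ ℕ} :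
    m ∈ freePart p N ↔ m ∈ N ∧ m p = 0 := by
  simp [freePart]

theorem exists_eq_add_single {m : ℕ →₀ ℕ} {p : ℕ} (h : m p ≠ 0) : ∃ n, m = n + single p 1 :=
  ⟨m - single p 1, (tsub_add_cancel_of_le (by simpa [Nat.one_le_iff_ne_zero] using h)).symm⟩

theorem card_freePart_add_card_colon (p : ℕ) (N : Finset (ℕ →₀ ℕ)) :
    (freePart p N).card + (colon p N).card = N.card := by
  classical
  rw [colon, Finset.card_preimage, freePart,
    ← Finset.card_filter_add_card_filter_not (s := N) (fun m => m p = 0)]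
  congr 2
  refine Finset.filter_congr fun m _ => ?_
  constructor
  · rintro ⟨n, rfl⟩
    simp
  · intro h
    obtain ⟨n, rfl⟩ := exists_eq_add_single h
    exact ⟨n, rfl⟩

namespace IsStable

variable {p t : ℕ} {N : Finset (ℕ →₀ ℕ)}

theorem freePart (h : IsStable p N) : IsStable (p + 1) (freePart p N) where
  eq_zero_of_lt m hm i hi := by
    rw [mem_freePart] at hm
    rcases (Nat.lt_succ_iff.1 hi).eq_or_lt with rfl | hi
    · exact hm.2
    · exact h.eq_zero_of_lt m hm.1 i hi
  exchange m i j hi hij hm := by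
    rw [mem_freePart] at hm ⊢
    refine ⟨h.exchange m i j (by omega) hij hm.1, ?_⟩
    have := hm.2
    simp only [Finsupp.add_apply, Nat.add_eq_zero_iff] at this ⊢
    exact ⟨this.1, Finsupp.single_eq_of_ne (by omega)⟩

theorem colon (h : IsStable p N) : IsStable p (colon p N) where
  eq_zero_of_lt m hm i hi := by
    have := h.eq_zero_of_lt _ (mem_colon.1 hm) i hi
    simp only [Finsupp.add_apply, Nat.add_eq_zero_iff] at this
    exact this.1
  exchange m i j hi hij hm := by
    rw [mem_colon, add_right_comm] at hm ⊢
    exact h.exchange _ i j hi hij hm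

/-- Any variable occurring in a member can be exchanged for y_p. Hence the part free of y_p is
strictly smaller than N, which drives the induction on |N|. -/
theorem colon_nonempty (h : IsStable p N) (hdeg : ∀ m ∈ N, m.degree = t + 1)
    (hN : N.Nonempty) : (OSeq.colon p N).Nonempty := by
  obtain ⟨m, hm⟩ := hN
  have hm0 : m ≠ 0 := by
    rintro rfl
    simpa using hdeg _ hm
  obtain ⟨j, hj⟩ := Finsupp.ne_iff.1 hm0
  obtain ⟨n, rfl⟩ := exists_eq_add_single hj
  have hpj : p ≤ j := by
    by_contra hlt
    exact hj (h.eq_zero_of_lt _ hm j (by omega))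
  refine ⟨n, mem_colon.2 ?_⟩
  rcases hpj.eq_or_lt with rfl | hlt
  · exact hm
  · exact h.exchange n p j le_rfl hlt hm

theorem degree_colon (hdeg : ∀ m ∈ N, m.degree = t + 1) :
    ∀ m ∈ OSeq.colon p N, m.degree = t := by
  intro m hm
  simpa using hdeg _ (mem_colon.1 hm)

/-- The exchange of y_{p+1} for y_p turns a member m y_{p+1} of N into m y_p. -/
theorem colon_freePart_subset (h : IsStable p N) :
    OSeq.colon (p + 1) (OSeq.freePart p N) ⊆ OSeq.freePart p (OSeq.colon p N) := by
  intro m hm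
  rw [mem_colon, mem_freePart] at hm
  rw [mem_freePart, mem_colon]
  refine ⟨h.exchange m p (p + 1) le_rfl (by omega) hm.1, ?_⟩
  have := hm.2
  simp only [Finsupp.add_apply, Nat.add_eq_zero_iff] at this
  exact this.1

/-- Let c be the size of the colon set. By induction on |N|, with p replaced by p + 1, the part free
of y_p has at most (c_⟨t+1⟩)^⟨t+1⟩ elements: its own colon set lies in the free part of the colon
set of N, to which Green's bound applies. Adding c gives c^⟨t+1⟩ by `macaulayBound_greenBound`. -/
theorem card_le_macaulayBound_of_green
    (green : ∀ (p : ℕ) (N : Finset (ℕ →₀ ℕ)), IsStable p N → (∀ m ∈ N, m.degree = t + 1) →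
      (OSeq.freePart p N).card ≤ greenBound (t + 1) N.card)
    (h : IsStable p N) (hdeg : ∀ m ∈ N, m.degree = t + 2) :
    N.card ≤ macaulayBound (t + 1) (OSeq.colon p N).card := by
  induction hn : N.card using Nat.strong_induction_on generalizing p N with
  | _ n ih =>
    subst hn
    rcases N.eq_empty_or_nonempty with rfl | hN
    · simp
    have hcard := card_freePart_add_card_colon p N
    have hpos := (h.colon_nonempty hdeg hN).card_pos
    have h0 := ih _ (by omega) h.freePart (fun m hm => hdeg m (mem_freePart.1 hm).1) rfl
    have h1 := green p _ h.colon (degree_colon hdeg)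
    have h2 := macaulayBound_mono (t + 1)
      ((Finset.card_le_card h.colon_freePart_subset).trans h1)
    have h3 := macaulayBound_greenBound t (OSeq.colon p N).card
    omega

/-- Green's hyperplane restriction theorem for stable sets of monomials. -/
theorem card_freePart_le (h : IsStable p N) (hdeg : ∀ m ∈ N, m.degree = t + 1) :
    (OSeq.freePart p N).card ≤ greenBound (t + 1) N.card := by
  induction t generalizing p N with
  | zero =>
    rw [greenBound_one]
    have hcard := card_freePart_add_card_colon p N
    rcases N.eq_empty_or_nonempty with rfl | hN
    · simp [OSeq.freePart]
    · have hpos := (h.colon_nonempty hdeg hN).card_pos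
      omega
  | succ t ih =>
    have hcard := card_freePart_add_card_colon p N
    -- Macaulay's bound into degree t + 2 uses Green's bound only in degree t + 1, and in turn gives
    -- |N| ≤ |N|_⟨t+2⟩ + c with c the size of the colon set; |N| - c counts the free part.
    have := le_greenBound_add (card_le_macaulayBound_of_green (fun p N => ih) h hdeg)
    change _ ≤ greenBound (t + 2) _
    omega

/-- Macaulay's bound for stable sets of monomials. -/
theorem card_le_macaulayBound (h : IsStable p N) (hdeg : ∀ m ∈ N, m.degree = t + 2) :
    N.card ≤ macaulayBound (t + 1) (OSeq.colon p N).card :=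
  card_le_macaulayBound_of_green (fun _ _ => card_freePart_le) h hdeg

end IsStable

end OSeq

/-! ### Compression of a set of monomials to a stable set -/

namespace OSeq

open Finsupp (single)

/-- The monomials dividing a member of `N` with quotient a variable. -/
noncomputable def shadow (N : Finset (ℕ →₀ ℕ)) : Finset (ℕ →₀ ℕ) := by
  classical
  exact N.biUnion fun m => m.support.image fun l => m - single l 1

theorem mem_shadow {N : Finset (ℕ →₀ ℕ)} {m : ℕ →₀ ℕ} :
    m ∈ shadow N ↔ ∃ l, m + single l 1 ∈ N := by
  classical
  simp only [shadow, Finset.mem_biUnion, Finset.mem_image, Finsupp.mem_support_iff]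
  constructor
  · rintro ⟨n, hn, l, hl, rfl⟩
    obtain ⟨n, rfl⟩ := exists_eq_add_single hl
    exact ⟨l, by simpa using hn⟩
  · rintro ⟨l, hl⟩
    exact ⟨_, hl, l, by simp, by simp⟩

theorem colon_subset_shadow (p : ℕ) (N : Finset (ℕ →₀ ℕ)) : colon p N ⊆ shadow N :=
  fun _ hm => mem_shadow.2 ⟨p, mem_colon.1 hm⟩

/-- The monomial `n` with `n_j = b`, `n_i + n_j = m_i + m_j`, and `n_l = m_l` for `l ≠ i, j`. -/
noncomputable def lineElt (i j : ℕ) (m : ℕ →₀ ℕ) (b : ℕ) : ℕ →₀ ℕ :=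
  (m.update i (m i + m j - b)).update j b

theorem lineElt_apply (i j : ℕ) (m : ℕ →₀ ℕ) (b l : ℕ) :
    lineElt i j m b l = if l = j then b else if l = i then m i + m j - b else m l := by
  simp [lineElt, Function.update_apply]

theorem lineElt_self (i j : ℕ) (m : ℕ →₀ ℕ) : lineElt i j m (m j) = m := by
  ext l
  rw [lineElt_apply]
  split_ifs with h1 h2
  · rw [h1]
  · rw [h2]; omega
  · rfl

theorem lineElt_lineElt {i j : ℕ} (hij : i ≠ j) {m : ℕ →₀ ℕ} {b : ℕ} (hb : b ≤ m i + m j) :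
    lineElt i j (lineElt i j m b) = lineElt i j m := by
  ext b' l
  simp only [lineElt_apply, hij, if_true, if_false]
  split_ifs <;> omega

theorem lineElt_add_smul {i j : ℕ} (hij : i ≠ j) {m : ℕ →₀ ℕ} {b : ℕ} (hb : b ≤ m j) :
    lineElt i j m b + (m j - b) • single j 1 = m + (m j - b) • single i 1 := by
  ext l
  simp only [Finsupp.add_apply, Finsupp.smul_apply, lineElt_apply, Finsupp.single_apply,
    smul_eq_mul]
  by_cases h1 : l = j
  · subst h1; simp [hij, hb]
  · by_cases h2 : l = i
    · subst h2; simp [Ne.symm hij, hij]; omega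
    · simp [h1, h2, Ne.symm h1, Ne.symm h2]

theorem lineElt_add_single_left {i j : ℕ} (hij : i ≠ j) {m : ℕ →₀ ℕ} {b : ℕ}
    (hb : b ≤ m i + m j) :
    lineElt i j (m + single i 1) b = lineElt i j m b + single i 1 := by
  ext l
  simp only [Finsupp.add_apply, lineElt_apply, Finsupp.single_apply, hij, if_true, if_false]
  split_ifs <;> omega

theorem lineElt_add_single_left_succ {i j : ℕ} (hij : i ≠ j) (m : ℕ →₀ ℕ) (b : ℕ) :
    lineElt i j (m + single i 1) (b + 1) = lineElt i j m b + single j 1 := by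
  ext l
  simp only [Finsupp.add_apply, lineElt_apply, Finsupp.single_apply, hij, if_true, if_false]
  split_ifs <;> omega

theorem lineElt_add_single_right {i j : ℕ} (hij : i ≠ j) (m : ℕ →₀ ℕ) :
    lineElt i j (m + single j 1) = lineElt i j (m + single i 1) := by
  ext b l
  simp only [Finsupp.add_apply, lineElt_apply, Finsupp.single_apply, hij, Ne.symm hij, if_true,
    if_false]
  split_ifs <;> omega

theorem lineElt_add_single_of_ne {i j l : ℕ} (hi : l ≠ i) (hj : l ≠ j) (m : ℕ →₀ ℕ)
    (b : ℕ) : lineElt i j (m + single l 1) b = lineElt i j m b + single l 1 := by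
  ext l'
  simp only [Finsupp.add_apply, lineElt_apply, Finsupp.single_apply, hi, hj, if_false]
  split_ifs <;> omega

open Classical in
/-- The `j`-th exponents of the members of `N` on the line through `m` in direction `(i, j)`. -/
noncomputable def lineSet (i j : ℕ) (N : Finset (ℕ →₀ ℕ)) (m : ℕ →₀ ℕ) : Finset ℕ :=
  (Finset.range (m i + m j + 1)).filter fun b => lineElt i j m b ∈ N

theorem mem_lineSet {i j : ℕ} {N : Finset (ℕ →₀ ℕ)} {m : ℕ →₀ ℕ} {b : ℕ} :
    b ∈ lineSet i j N m ↔ b ≤ m i + m j ∧ lineElt i j m b ∈ N := by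
  simp [lineSet]

theorem apply_mem_lineSet {i j : ℕ} {N : Finset (ℕ →₀ ℕ)} {m : ℕ →₀ ℕ}
    (hm : m ∈ N) : m j ∈ lineSet i j N m :=
  mem_lineSet.2 ⟨by omega, by rwa [lineElt_self]⟩

theorem lineSet_lineElt {i j : ℕ} (hij : i ≠ j) (N : Finset (ℕ →₀ ℕ)) {m : ℕ →₀ ℕ} {b : ℕ}
    (hb : b ≤ m i + m j) : lineSet i j N (lineElt i j m b) = lineSet i j N m := by
  ext b'
  rw [mem_lineSet, mem_lineSet, lineElt_lineElt hij hb, lineElt_apply, lineElt_apply, if_neg hij,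
    if_pos rfl, if_pos rfl, Nat.sub_add_cancel hb]

/-- The number of elements of `B` below `b`. -/
def rankIn (B : Finset ℕ) (b : ℕ) : ℕ := (B.filter (· < b)).card

theorem rankIn_le (B : Finset ℕ) (b : ℕ) : rankIn B b ≤ b := by
  calc rankIn B b ≤ (Finset.range b).card :=
        Finset.card_le_card fun x hx => by simpa using (Finset.mem_filter.1 hx).2
    _ = b := Finset.card_range b

theorem rankIn_lt_rankIn {B : Finset ℕ} {b c : ℕ} (hb : b ∈ B) (h : b < c) :
    rankIn B b < rankIn B c := by
  refine Finset.card_lt_card (Finset.ssubset_iff_of_subset ?_ |>.2 ⟨b, ?_, ?_⟩)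
  · intro x hx
    rw [Finset.mem_filter] at hx ⊢
    exact ⟨hx.1, hx.2.trans h⟩
  · simp [hb, h]
  · simp

theorem rankIn_lt_card {B : Finset ℕ} {b : ℕ} (hb : b ∈ B) : rankIn B b < B.card :=
  Finset.card_lt_card (Finset.filter_ssubset.2 ⟨b, hb, lt_irrefl b⟩)

theorem rankIn_injOn (B : Finset ℕ) : Set.InjOn (rankIn B) B := by
  intro b hb c hc h
  rcases lt_trichotomy b c with hbc | hbc | hbc
  · exact absurd h (rankIn_lt_rankIn hb hbc).ne
  · exact hbc
  · exact absurd h (rankIn_lt_rankIn hc hbc).ne'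

theorem exists_rankIn_eq {B : Finset ℕ} {r : ℕ} (hr : r < B.card) : ∃ b ∈ B, rankIn B b = r := by
  have h := Finset.surj_on_of_inj_on_of_card_le (s := B) (t := Finset.range B.card)
    (fun b _ => rankIn B b) (fun b hb => Finset.mem_range.2 (rankIn_lt_card hb))
    (fun a b ha hb hab => rankIn_injOn B ha hb hab) (by simp) r (Finset.mem_range.2 hr)
  obtain ⟨b, hb, h⟩ := h
  exact ⟨b, hb, h.symm⟩

/-- Move `m` to the position on its line which is the rank of `m` among the members of `N`. -/
noncomputable def pushDown (i j : ℕ) (N : Finset (ℕ →₀ ℕ)) (m : ℕ →₀ ℕ) : ℕ →₀ ℕ :=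
  lineElt i j m (rankIn (lineSet i j N m) (m j))

open Classical in
/-- The compression of `N` along the lines in direction `(i, j)`. -/
noncomputable def compress (i j : ℕ) (N : Finset (ℕ →₀ ℕ)) : Finset (ℕ →₀ ℕ) :=
  N.image (pushDown i j N)

/-- On each line the ranks of the members fill an initial segment of positions, and moving along a
line does not change its line set. -/
theorem mem_compress {i j : ℕ} (hij : i ≠ j) {N : Finset (ℕ →₀ ℕ)} {m : ℕ →₀ ℕ} :
    m ∈ compress i j N ↔ m j < (lineSet i j N m).card := by
  rw [compress, Finset.mem_image]
  constructor
  · rintro ⟨n, hn, rfl⟩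
    have hr := rankIn_le (lineSet i j N n) (n j)
    rw [pushDown, lineSet_lineElt hij N (by omega), lineElt_apply, if_pos rfl]
    exact rankIn_lt_card (apply_mem_lineSet hn)
  · intro h
    obtain ⟨b, hb, hr⟩ := exists_rankIn_eq h
    obtain ⟨hb, hN⟩ := mem_lineSet.1 hb
    refine ⟨_, hN, ?_⟩
    rw [pushDown, lineElt_lineElt hij hb, lineSet_lineElt hij N hb, lineElt_apply, if_pos rfl, hr,
      lineElt_self]

theorem pushDown_injOn {i j : ℕ} (hij : i ≠ j) (N : Finset (ℕ →₀ ℕ)) :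
    Set.InjOn (pushDown i j N) N := by
  intro m hm n hn h
  have hrm := rankIn_le (lineSet i j N m) (m j)
  have hrn := rankIn_le (lineSet i j N n) (n j)
  have hB : lineSet i j N m = lineSet i j N n := by
    rw [← lineSet_lineElt hij N (m := m) (b := rankIn (lineSet i j N m) (m j)) (by omega),
      ← lineSet_lineElt hij N (m := n) (b := rankIn (lineSet i j N n) (n j)) (by omega)]
    exact congrArg (lineSet i j N) h
  have hL : lineElt i j m = lineElt i j n := by
    rw [← lineElt_lineElt hij (m := m) (b := rankIn (lineSet i j N m) (m j)) (by omega),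
      ← lineElt_lineElt hij (m := n) (b := rankIn (lineSet i j N n) (n j)) (by omega)]
    exact congrArg (lineElt i j) h
  have hj := DFunLike.congr_fun h j
  rw [pushDown, pushDown, lineElt_apply, lineElt_apply, if_pos rfl, if_pos rfl, hB] at hj
  have hmn : m j = n j :=
    rankIn_injOn (lineSet i j N n) (hB ▸ apply_mem_lineSet hm) (apply_mem_lineSet hn) hj
  rw [← lineElt_self i j m, ← lineElt_self i j n, hL, hmn]

theorem card_compress {i j : ℕ} (hij : i ≠ j) (N : Finset (ℕ →₀ ℕ)) :
    (compress i j N).card = N.card :=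
  Finset.card_image_of_injOn (pushDown_injOn hij N)

/-- An additive identity, so that the effect on degree and weight follows by applying additive maps.
-/
theorem pushDown_add_smul {i j : ℕ} (hij : i ≠ j) (N : Finset (ℕ →₀ ℕ)) (m : ℕ →₀ ℕ) :
    pushDown i j N m + (m j - rankIn (lineSet i j N m) (m j)) • single j 1 =
      m + (m j - rankIn (lineSet i j N m) (m j)) • single i 1 :=
  lineElt_add_smul hij (rankIn_le _ _)

theorem degree_compress {i j t : ℕ} (hij : i ≠ j) {N : Finset (ℕ →₀ ℕ)}
    (hdeg : ∀ m ∈ N, m.degree = t) : ∀ m ∈ compress i j N, m.degree = t := by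
  intro m hm
  obtain ⟨n, hn, rfl⟩ := Finset.mem_image.1 hm
  have := congrArg Finsupp.degree (pushDown_add_smul hij N n)
  simp only [map_add, map_nsmul, Finsupp.degree_single] at this
  rw [← hdeg n hn]
  omega

/-- The weight `∑ l m_l` of a monomial. -/
noncomputable def indexWeight : (ℕ →₀ ℕ) →+ ℕ := Finsupp.liftAddHom fun l => AddMonoidHom.mulLeft l

theorem indexWeight_single (l : ℕ) : indexWeight (single l 1) = l := by
  simp [indexWeight]

theorem indexWeight_pushDown {i j : ℕ} (hij : i ≠ j) (N : Finset (ℕ →₀ ℕ)) (m : ℕ →₀ ℕ) :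
    indexWeight (pushDown i j N m) + (m j - rankIn (lineSet i j N m) (m j)) * j =
      indexWeight m + (m j - rankIn (lineSet i j N m) (m j)) * i := by
  simpa only [map_add, map_nsmul, indexWeight_single, smul_eq_mul] using
    congrArg indexWeight (pushDown_add_smul hij N m)

/-- Termination of compression: moving k units of exponent from j to i lowers the weight by k(j -
i). If no member moves, the compressed set lies in N and has the same size. -/
theorem sum_indexWeight_compress_lt {i j : ℕ} (hij : i < j) {N : Finset (ℕ →₀ ℕ)}
    (h : compress i j N ≠ N) :
    ∑ m ∈ compress i j N, indexWeight m < ∑ m ∈ N, indexWeight m := by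
  rw [compress, Finset.sum_image (pushDown_injOn hij.ne N)]
  refine Finset.sum_lt_sum (fun m _ => ?_) ?_
  · have h1 := indexWeight_pushDown hij.ne N m
    have h2 := Nat.mul_le_mul_left (m j - rankIn (lineSet i j N m) (m j)) hij.le
    omega
  · by_contra! hle
    refine h (Finset.eq_of_subset_of_card_le ?_ (card_compress hij.ne N).ge)
    intro m hm
    obtain ⟨n, hn, rfl⟩ := Finset.mem_image.1 hm
    have h1 := indexWeight_pushDown hij.ne N n
    have h2 := hle n hn
    have h3 : n j - rankIn (lineSet i j N n) (n j) = 0 := by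
      by_contra h0
      have := Nat.mul_lt_mul_of_pos_left hij (Nat.pos_of_ne_zero h0)
      omega
    have h4 := rankIn_le (lineSet i j N n) (n j)
    rw [pushDown, show rankIn (lineSet i j N n) (n j) = n j by omega, lineElt_self]
    exact hn

/-- A member at position b on the line of m y_i has a divisor at position b (divide by y_i) and one
at b - 1 (divide by y_j) on the line of m. Keeping positions below b₀ and shifting those above is
injective. -/
theorem card_erase_lineSet_le {i j : ℕ} (hij : i ≠ j) (N : Finset (ℕ →₀ ℕ)) (m : ℕ →₀ ℕ)
    {b₀ : ℕ} (hb₀ : b₀ ≤ m i + m j + 1) :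
    ((lineSet i j N (m + single i 1)).erase b₀).card ≤ (lineSet i j (shadow N) m).card := by
  refine Finset.card_le_card_of_injOn (fun b => if b < b₀ then b else b - 1) ?_ ?_
  · intro b hb
    simp only [Finset.coe_erase, Set.mem_sdiff, Finset.mem_coe, Set.mem_singleton_iff] at hb
    obtain ⟨hb, hne⟩ := hb
    obtain ⟨hle, hb⟩ := mem_lineSet.1 hb
    simp only [Finsupp.add_apply, Finsupp.single_eq_same, Finsupp.single_eq_of_ne (Ne.symm hij)]
      at hle
    simp only [Finset.mem_coe]
    split_ifs with h
    · exact mem_lineSet.2 ⟨by omega, mem_shadow.2 ⟨i, by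
        rwa [← lineElt_add_single_left hij (by omega)]⟩⟩
    · obtain ⟨b, rfl⟩ : ∃ c, b = c + 1 := ⟨b - 1, by omega⟩
      exact mem_lineSet.2 ⟨by omega, mem_shadow.2 ⟨j, by
        rwa [← lineElt_add_single_left_succ hij]⟩⟩
  · intro b hb c hc h
    simp only [Finset.coe_erase, Set.mem_sdiff, Finset.mem_coe, Set.mem_singleton_iff] at hb hc h
    split_ifs at h <;> omega

theorem shadow_compress_subset {i j : ℕ} (hij : i ≠ j) (N : Finset (ℕ →₀ ℕ)) :
    shadow (compress i j N) ⊆ compress i j (shadow N) := by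
  intro m hm
  obtain ⟨l, hl⟩ := mem_shadow.1 hm
  rw [mem_compress hij] at hl ⊢
  by_cases hli : l = i
  · subst hli
    simp only [Finsupp.add_apply, Finsupp.single_eq_of_ne (Ne.symm hij), add_zero] at hl
    -- If a position is missing from the upper line, nothing is erased and the shadow has at least
    -- as many points on the lower line. If the line is full, losing one point still leaves every
    -- position of the lower line.
    by_cases h : ∃ b₀ ≤ m l + m j + 1, b₀ ∉ lineSet l j N (m + single l 1)
    · obtain ⟨b₀, hb₀, hmem⟩ := h
      have := card_erase_lineSet_le hij N m hb₀
      rw [Finset.erase_eq_of_notMem hmem] at this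
      omega
    · push Not at h
      have h1 := card_erase_lineSet_le hij N m (b₀ := 0) (by omega)
      rw [Finset.card_erase_of_mem (h 0 (by omega))] at h1
      have h2 : (Finset.range (m l + m j + 2)).card ≤ _ := Finset.card_le_card
        (fun b hb => h b (by have := Finset.mem_range.1 hb; omega))
      rw [Finset.card_range] at h2
      omega
  · by_cases hlj : l = j
    · subst hlj
      have hB : lineSet i l N (m + single l 1) = lineSet i l N (m + single i 1) := by
        ext b
        simp only [mem_lineSet, lineElt_add_single_right hij, Finsupp.add_apply,
          Finsupp.single_eq_same, Finsupp.single_eq_of_ne hij,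
          Finsupp.single_eq_of_ne (Ne.symm hij)]
        rw [show m i + 0 + (m l + 1) = m i + 1 + (m l + 0) by omega]
      rw [hB, Finsupp.add_apply, Finsupp.single_eq_same] at hl
      have h1 := card_erase_lineSet_le hij N m (b₀ := 0) (by omega)
      have h2 := Finset.pred_card_le_card_erase (s := lineSet i l N (m + single i 1)) (a := 0)
      omega
    · rw [Finsupp.add_apply, Finsupp.single_eq_of_ne (Ne.symm hlj), add_zero] at hl
      refine hl.trans_le (Finset.card_le_card fun b hb => ?_)
      obtain ⟨hb, hN⟩ := mem_lineSet.1 hb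
      rw [lineElt_add_single_of_ne hli hlj] at hN
      simp only [Finsupp.add_apply, Finsupp.single_eq_of_ne (Ne.symm hlj),
        Finsupp.single_eq_of_ne (Ne.symm hli), add_zero] at hb
      exact mem_lineSet.2 ⟨hb, mem_shadow.2 ⟨l, hN⟩⟩

/-- The monomials m y_i and m y_j lie on the same line, the former one position lower, and N meets
every line in an initial segment. -/
theorem isStable_zero_of_compress_eq {N : Finset (ℕ →₀ ℕ)}
    (h : ∀ i j, i < j → compress i j N = N) : IsStable 0 N where
  eq_zero_of_lt := by simp
  exchange m i j _ hij hm := by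
    rw [← h i j hij, mem_compress hij.ne] at hm ⊢
    have hB : lineSet i j N (m + single j 1) = lineSet i j N (m + single i 1) := by
      ext b
      simp only [mem_lineSet, lineElt_add_single_right hij.ne, Finsupp.add_apply,
        Finsupp.single_eq_same, Finsupp.single_eq_of_ne hij.ne,
        Finsupp.single_eq_of_ne hij.ne']
      rw [show m i + 0 + (m j + 1) = m i + 1 + (m j + 0) by omega]
    rw [hB] at hm
    simp only [Finsupp.add_apply, Finsupp.single_eq_same, Finsupp.single_eq_of_ne hij.ne'] at *
    omega

/-- Macaulay's bound for sets of monomials of the same degree. -/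
theorem card_le_macaulayBound_shadow {t : ℕ} {N : Finset (ℕ →₀ ℕ)}
    (hdeg : ∀ m ∈ N, m.degree = t + 2) : N.card ≤ macaulayBound (t + 1) (shadow N).card := by
  induction hw : ∑ m ∈ N, indexWeight m using Nat.strong_induction_on generalizing N with
  | _ w ih =>
    subst hw
    by_cases h : ∀ i j, i < j → compress i j N = N
    · exact ((isStable_zero_of_compress_eq h).card_le_macaulayBound hdeg).trans
        (macaulayBound_mono _ (Finset.card_le_card (colon_subset_shadow 0 N)))
    · push Not at h
      obtain ⟨i, j, hij, hne⟩ := h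
      have h1 := ih _ (sum_indexWeight_compress_lt hij hne) (degree_compress hij.ne hdeg) rfl
      rw [card_compress hij.ne] at h1
      refine h1.trans (macaulayBound_mono _ ?_)
      rw [← card_compress hij.ne (shadow N)]
      exact Finset.card_le_card (shadow_compress_subset hij.ne N)

end OSeq

/-! ### Initial segments of monomials -/

namespace OSeq

open Finsupp (single)

/-- The monomials of degree `t` in the variables `y_0, …, y_{n-1}`. -/
noncomputable def fullSet (n t : ℕ) : Finset (ℕ →₀ ℕ) := Finset.finsuppAntidiag (Finset.range n) t

theorem mem_fullSet {n t : ℕ} {m : ℕ →₀ ℕ} :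
    m ∈ fullSet n t ↔ m.degree = t ∧ ∀ i, n ≤ i → m i = 0 := by
  rw [fullSet, Finset.mem_finsuppAntidiag', Finsupp.degree_apply, Finsupp.sum]
  refine and_congr_right fun _ => ?_
  constructor
  · intro h i hi
    by_contra h0
    have := h (Finsupp.mem_support_iff.2 h0)
    rw [Finset.mem_range] at this
    omega
  · intro h i hi
    rw [Finset.mem_range]
    by_contra h0
    exact (Finsupp.mem_support_iff.1 hi) (h i (by omega))

theorem fullSet_mono {n n' : ℕ} (h : n ≤ n') (t : ℕ) : fullSet n t ⊆ fullSet n' t := by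
  intro m hm
  rw [mem_fullSet] at hm ⊢
  exact ⟨hm.1, fun i hi => hm.2 i (by omega)⟩

theorem of_add_single_mem_fullSet {n t l : ℕ} {m : ℕ →₀ ℕ} (h : m + single l 1 ∈ fullSet n (t + 1)) :
    m ∈ fullSet n t := by
  rw [mem_fullSet] at h ⊢
  refine ⟨by simpa using h.1, fun i hi => ?_⟩
  have := h.2 i hi
  simp only [Finsupp.add_apply, Nat.add_eq_zero_iff] at this
  exact this.1

theorem card_fullSet (n t : ℕ) : (fullSet n (t + 1)).card = (n + t).choose (t + 1) := by
  rw [fullSet, Finset.card_finsuppAntidiag_nat_eq_choose, Finset.card_range]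
  rfl

theorem choose_add_unique {t k l r s : ℕ} (hr : r < k.choose t) (hs : s < l.choose t)
    (h : k.choose (t + 1) + r = l.choose (t + 1) + s) : k = l :=
  le_antisymm (le_of_choose_add_le hs h.le) (le_of_choose_add_le hr h.ge)

/-- The index `k(t+1)` of the binomial expansion of `x`. -/
noncomputable def topIndex (t x : ℕ) : ℕ := (exists_choose_add t x).choose

theorem topIndex_choose_add {t k r : ℕ} (hr : r < k.choose t) :
    topIndex t (k.choose (t + 1) + r) = k := by
  obtain ⟨s, -, h, hs⟩ := (exists_choose_add t (k.choose (t + 1) + r)).choose_spec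
  exact (choose_add_unique hr hs h).symm

open Classical in
/-- The first `a` monomials of degree `t` in `y_0, y_1, …`, in the order that compares the
largest variables first. -/
noncomputable def segment : ℕ → ℕ → Finset (ℕ →₀ ℕ)
  | 0, a => if a = 0 then ∅ else {0}
  | t + 1, a =>
    fullSet (topIndex t a - t) (t + 1) ∪
      (segment t (a - (topIndex t a).choose (t + 1))).image (· + single (topIndex t a - t) 1)

/-- The C(n+t, t+1) monomials in y_0, …, y_{n-1} come first; the next ones are y_n times the first r
monomials of degree t. -/
theorem mem_segment_choose_add {t n r : ℕ} (hr : r < (n + t).choose t) {m : ℕ →₀ ℕ} :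
    m ∈ segment (t + 1) ((n + t).choose (t + 1) + r) ↔
      m ∈ fullSet n (t + 1) ∨ ∃ q ∈ segment t r, q + single n 1 = m := by
  rw [segment, topIndex_choose_add hr, Nat.add_sub_cancel, Nat.add_sub_cancel_left,
    Finset.mem_union, Finset.mem_image]

theorem exists_choose_add' (t x : ℕ) :
    ∃ n r, x = (n + t).choose (t + 1) + r ∧ r < (n + t).choose t := by
  obtain ⟨k, r, hk, h⟩ := exists_choose_add t x
  obtain ⟨n, rfl⟩ := Nat.exists_eq_add_of_le' hk
  exact ⟨n, r, h⟩

/-- There are C(n+t, t) monomials of degree t in y_0, …, y_n, and a shorter initial segment needs no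
further variable. -/
theorem segment_subset_fullSet {t n r : ℕ} (hr : r < (n + t).choose t) :
    segment t r ⊆ fullSet (n + 1) t := by
  induction t generalizing n r with
  | zero =>
    have : r = 0 := by simpa using hr
    simp [segment, this]
  | succ t ih =>
    obtain ⟨k, s, rfl, hs⟩ := exists_choose_add' t r
    have hkn : k ≤ n := by
      have := le_of_choose_add_le (k := k + t) (r := s) (l := n + t + 1) (s := 0) (t := t)
        (Nat.choose_pos (by omega)) (by rw [Nat.add_assoc n]; omega)
      by_contra h
      obtain rfl : k = n + 1 := by omega
      rw [show n + 1 + t = n + (t + 1) by omega] at hr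
      omega
    intro m hm
    rw [mem_segment_choose_add hs] at hm
    rcases hm with hm | ⟨q, hq, rfl⟩
    · exact fullSet_mono (by omega) _ hm
    · have hq' := mem_fullSet.1 (ih hs hq)
      refine mem_fullSet.2 ⟨by simp [hq'.1], fun i hi => ?_⟩
      rw [Finsupp.add_apply, hq'.2 i (by omega), Finsupp.single_eq_of_ne (by omega), add_zero]

theorem degree_of_mem_segment {t a : ℕ} {m : ℕ →₀ ℕ} (hm : m ∈ segment t a) : m.degree = t := by
  induction t generalizing a m with
  | zero =>
    rw [segment] at hm
    split_ifs at hm with h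
    · simp at hm
    · rw [Finset.mem_singleton.1 hm, map_zero]
  | succ t ih =>
    obtain ⟨k, s, rfl, hs⟩ := exists_choose_add' t a
    rw [mem_segment_choose_add hs] at hm
    rcases hm with hm | ⟨q, hq, rfl⟩
    · exact (mem_fullSet.1 hm).1
    · simp [ih hq]

theorem card_segment {t a : ℕ} (h : t = 0 → a ≤ 1) : (segment t a).card = a := by
  classical
  induction t generalizing a with
  | zero =>
    have := h rfl
    interval_cases a <;> simp [segment]
  | succ t ih =>
    obtain ⟨k, s, rfl, hs⟩ := exists_choose_add' t a
    have hS : segment (t + 1) ((k + t).choose (t + 1) + s) =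
        fullSet k (t + 1) ∪ (segment t s).image (· + single k 1) := by
      ext m
      rw [mem_segment_choose_add hs, Finset.mem_union, Finset.mem_image]
    rw [hS, Finset.card_union_of_disjoint, card_fullSet,
      Finset.card_image_of_injective _ (add_left_injective _), ih]
    · rintro rfl
      simp at hs
      omega
    · rw [Finset.disjoint_left]
      intro m hm hm'
      obtain ⟨q, -, rfl⟩ := Finset.mem_image.1 hm'
      have := (mem_fullSet.1 hm).2 k le_rfl
      simp at this

theorem segment_zero_right (t : ℕ) : segment t 0 = ∅ :=
  Finset.card_eq_zero.1 (card_segment fun _ => zero_le_one)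

/-- Raising C(n+t, t+1) to C(n+t+1, t+2) keeps the number n of variables that are used up. If b uses
up fewer than a, every divisor lies in the full part of the segment of a; if equally many, a divisor
containing y_n reduces to the remainders after division by y_n. -/
theorem shadow_segment_subset {t a b : ℕ} (h : b ≤ macaulayBound t a) :
    shadow (segment (t + 1) b) ⊆ segment t a := by
  induction t generalizing a b with
  | zero =>
    have : b = 0 := by simpa [macaulayBound] using h
    subst this
    simp [segment_zero_right, shadow]
  | succ t ih =>
    obtain ⟨n, r, rfl, hr⟩ := exists_choose_add' t a
    obtain ⟨n', r', rfl, hr'⟩ := exists_choose_add' (t + 1) b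
    rw [macaulayBound_choose_add (by omega) hr] at h
    have hn : n' ≤ n := by
      have := le_of_choose_add_le (macaulayBound_lt (by omega) hr) h
      omega
    intro m hm
    obtain ⟨l, hl⟩ := mem_shadow.1 hm
    rw [mem_segment_choose_add hr'] at hl
    rw [mem_segment_choose_add hr]
    rcases hl with hl | ⟨q, hq, hql⟩
    · exact Or.inl (fullSet_mono hn _ (of_add_single_mem_fullSet hl))
    have hqf := segment_subset_fullSet hr' hq
    have hmf : m ∈ fullSet (n' + 1) (t + 1) := by
      rw [mem_fullSet] at hqf
      refine of_add_single_mem_fullSet (l := l) (mem_fullSet.2 ?_)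
      rw [← hql]
      refine ⟨by simp [hqf.1], fun i hi => ?_⟩
      rw [Finsupp.add_apply, hqf.2 i hi, Finsupp.single_eq_of_ne (by omega), add_zero]
    rcases hn.eq_or_lt with rfl | hlt
    · have h : (n' + t + 1).choose (t + 2) + r' ≤ (n' + t + 1).choose (t + 2) + _ := h
      have hsub := ih (a := r) (b := r') (by omega)
      by_cases hm0 : m n' = 0
      · refine Or.inl (mem_fullSet.2 ⟨(mem_fullSet.1 hmf).1, fun i hi => ?_⟩)
        rcases hi.eq_or_lt with rfl | hi
        · exact hm0
        · exact (mem_fullSet.1 hmf).2 i hi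
      · right
        obtain ⟨m, rfl⟩ := exists_eq_add_single hm0
        refine ⟨m, hsub (mem_shadow.2 ⟨l, ?_⟩), rfl⟩
        rw [add_right_comm] at hql
        rwa [← add_right_cancel hql]
    · exact Or.inl (fullSet_mono (by omega) _ hmf)

end OSeq

/-! ### Standard monomials and monomial ideals -/

namespace OSeq

attribute [local instance] MvPolynomial.gradedAlgebra

open Finsupp (single)
open MvPolynomial

section Greedy

variable {K V ι : Type*} [Field K] [AddCommGroup V] [Module K V] [LinearOrder ι]

open Classical in
/-- The indices `i ∈ S` such that `v i` is not in the span of the preceding vectors. -/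
noncomputable def greedyBasis (K : Type*) {V ι : Type*} [Field K] [AddCommGroup V] [Module K V]
    [LinearOrder ι] (v : ι → V) (S : Finset ι) : Finset ι :=
  S.filter fun i => v i ∉ Submodule.span K (v '' {j | j ∈ S ∧ j < i})

theorem mem_greedyBasis {v : ι → V} {S : Finset ι} {i : ι} :
    i ∈ greedyBasis K v S ↔ i ∈ S ∧ v i ∉ Submodule.span K (v '' {j | j ∈ S ∧ j < i}) := by
  simp [greedyBasis]

/-- Add the indices in increasing order: a new maximum does not affect the choice among the earlier
ones, and is chosen exactly when it enlarges the span. -/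
theorem greedyBasis_spec (v : ι → V) (S : Finset ι) :
    LinearIndepOn K v (greedyBasis K v S : Set ι) ∧
      Submodule.span K (v '' (greedyBasis K v S : Set ι)) = Submodule.span K (v '' (S : Set ι)) := by
  classical
  induction S using Finset.induction_on_max with
  | empty => simp [greedyBasis]
  | insert a S hlt ih =>
    have haS : a ∉ S := fun h => lt_irrefl _ (hlt a h)
    have hS : ({j | j ∈ insert a S ∧ j < a} : Set ι) = S := by
      ext j
      simp only [Finset.mem_insert, Set.mem_ofPred_eq, Finset.mem_coe]
      exact ⟨fun h => h.1.resolve_left h.2.ne, fun h => ⟨Or.inr h, hlt j h⟩⟩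
    have hmem : ∀ i ∈ S, (i ∈ greedyBasis K v (insert a S) ↔ i ∈ greedyBasis K v S) := by
      intro i hi
      have : ({j | j ∈ insert a S ∧ j < i} : Set ι) = {j | j ∈ S ∧ j < i} := by
        ext j
        simp only [Finset.mem_insert, Set.mem_ofPred_eq]
        refine and_congr_left fun hji => or_iff_right ?_
        rintro rfl
        exact lt_asymm hji (hlt i hi)
      rw [mem_greedyBasis, mem_greedyBasis, this]
      simp [hi]
    have haG : a ∉ greedyBasis K v S := fun h => haS (mem_greedyBasis.1 h).1
    by_cases ha : v a ∈ Submodule.span K (v '' (S : Set ι))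
    · have : greedyBasis K v (insert a S) = greedyBasis K v S := by
        ext i
        by_cases hi : i ∈ S
        · exact hmem i hi
        · refine iff_of_false (fun h => ?_) (fun h => hi (mem_greedyBasis.1 h).1)
          obtain ⟨h1, h2⟩ := mem_greedyBasis.1 h
          obtain rfl := (Finset.mem_insert.1 h1).resolve_right hi
          rw [hS] at h2
          exact h2 ha
      rw [this, Finset.coe_insert, Set.image_insert_eq, Submodule.span_insert_eq_span ha]
      exact ih
    · have : greedyBasis K v (insert a S) = insert a (greedyBasis K v S) := by
        ext i
        by_cases hi : i ∈ S
        · rw [hmem i hi, Finset.mem_insert, or_iff_right]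
          rintro rfl
          exact haS hi
        · rw [mem_greedyBasis, Finset.mem_insert, Finset.mem_insert]
          constructor
          · rintro ⟨h1, -⟩
            exact h1.imp_right fun h => absurd h hi
          · rintro (rfl | h)
            · exact ⟨Or.inl rfl, by rwa [hS]⟩
            · exact absurd (mem_greedyBasis.1 h).1 hi
      rw [this, Finset.coe_insert, Finset.coe_insert, Set.image_insert_eq, Set.image_insert_eq,
        Submodule.span_insert, Submodule.span_insert, ih.2,
        linearIndepOn_insert (by simpa using haG), ih.2]
      exact ⟨⟨ih.1, ha⟩, rfl⟩

theorem finrank_span_eq_card_greedyBasis (v : ι → V) (S : Finset ι) :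
    Module.finrank K (Submodule.span K (v '' (S : Set ι))) = (greedyBasis K v S).card := by
  rw [← (greedyBasis_spec v S).2, Set.image_eq_range]
  have h : LinearIndependent K fun i : (greedyBasis K v S : Set ι) => v i :=
    (greedyBasis_spec v S).1
  rw [finrank_span_eq_card h]
  simp

end Greedy

variable {K : Type*} [Field K] {p : ℕ}

/-- The monomials of degree `t` in `K[x_1, …, x_p]`, ordered lexicographically. -/
noncomputable def degreeMonomials (p t : ℕ) : Finset (Lex (Fin p →₀ ℕ)) :=
  (Finsupp.finite_of_degree_eq (σ := Fin p) t).toFinset.map toLex.toEmbedding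

theorem mem_degreeMonomials {t : ℕ} {m : Lex (Fin p →₀ ℕ)} :
    m ∈ degreeMonomials p t ↔ (ofLex m).degree = t := by
  simp [degreeMonomials]

/-- The class of a monomial modulo `I`. -/
noncomputable def monomialClass (I : Ideal (MvPolynomial (Fin p) K)) (m : Lex (Fin p →₀ ℕ)) :
    MvPolynomial (Fin p) K ⧸ I :=
  Ideal.Quotient.mk I (monomial (ofLex m) 1)

/-- The standard monomials of degree `t`. -/
noncomputable def standardMonomials (I : Ideal (MvPolynomial (Fin p) K)) (t : ℕ) :
    Finset (Lex (Fin p →₀ ℕ)) :=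
  greedyBasis K (monomialClass I) (degreeMonomials p t)

theorem homogeneousSubmodule_eq_span (t : ℕ) :
    homogeneousSubmodule (Fin p) K t =
      Submodule.span K ((fun m => monomial (ofLex m) (1 : K)) '' (degreeMonomials p t : Set _)) := by
  rw [homogeneousSubmodule_eq_finsupp_supported, AddMonoidAlgebra.supported_eq_span_single]
  congr 1
  ext f
  simp only [Set.mem_image, Set.mem_ofPred_eq, Finset.mem_coe, mem_degreeMonomials]
  exact ⟨fun ⟨m, hm, h⟩ => ⟨toLex m, hm, h⟩, fun ⟨m, hm, h⟩ => ⟨ofLex m, hm, h⟩⟩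

/-- Rank–nullity for R_t → R/I, whose kernel is I_t and whose image is spanned by the classes of the
monomials of degree t. -/
theorem hilbertFunction_eq_card (I : Ideal (MvPolynomial (Fin p) K)) (t : ℕ) :
    hilbertFunction I t = (standardMonomials I t).card := by
  have hspan := homogeneousSubmodule_eq_span (K := K) (p := p) t
  have hfin : Module.Finite K (homogeneousSubmodule (Fin p) K t) := by
    rw [hspan]
    exact FiniteDimensional.span_of_finite K ((Finset.finite_toSet _).image _)
  set W := homogeneousSubmodule (Fin p) K t with hW
  set q : MvPolynomial (Fin p) K →ₗ[K] MvPolynomial (Fin p) K ⧸ I :=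
    (Ideal.Quotient.mkₐ K I).toLinearMap with hq
  have hker : LinearMap.ker q = I.restrictScalars K := by
    ext f
    simp [hq, Ideal.Quotient.eq_zero_iff_mem]
  have hrn := LinearMap.finrank_range_add_finrank_ker (q.domRestrict W)
  have h1 : LinearMap.range (q.domRestrict W) =
      Submodule.span K (monomialClass I '' (degreeMonomials p t : Set _)) := by
    rw [LinearMap.range_domRestrict, hspan, Submodule.map_span, ← Set.image_comp]
    rfl
  have h2 : Module.finrank K (LinearMap.ker (q.domRestrict W)) =
      Module.finrank K (idealDegreePart I t) := by
    rw [LinearMap.ker_domRestrict, hker, idealDegreePart, ← hW, inf_comm,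
      ← Submodule.map_comap_subtype]
    exact (LinearEquiv.finrank_eq (Submodule.equivSubtypeMap W _))
  rw [hilbertFunction, ← hW, ← hrn, h1, h2, finrank_span_eq_card_greedyBasis, standardMonomials]
  omega

/-- If m is a combination of smaller monomials modulo I, multiplication by x_i gives such a
combination for m x_i, as the lexicographic order is compatible with multiplication. -/
theorem standardMonomials_of_add {I : Ideal (MvPolynomial (Fin p) K)} {t : ℕ}
    {m : Fin p →₀ ℕ} {i : Fin p} (h : toLex (m + single i 1) ∈ standardMonomials I (t + 1)) :
    toLex m ∈ standardMonomials I t := by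
  rw [standardMonomials, mem_greedyBasis, mem_degreeMonomials] at h ⊢
  refine ⟨by simpa using h.1, fun hm => h.2 ?_⟩
  have h1 := Submodule.mem_map_of_mem
    (f := LinearMap.mulRight K (Ideal.Quotient.mk I (X i : MvPolynomial (Fin p) K))) hm
  rw [Submodule.map_span] at h1
  have hmul : ∀ n : Fin p →₀ ℕ, monomialClass I (toLex n) * Ideal.Quotient.mk I (X i) =
      monomialClass I (toLex (n + single i 1)) := by
    intro n
    rw [monomialClass, monomialClass, ← map_mul, X, monomial_mul, one_mul]
    rfl
  rw [LinearMap.mulRight_apply, hmul] at h1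
  refine Submodule.span_mono ?_ h1
  rintro _ ⟨_, ⟨n, ⟨hn, hlt⟩, rfl⟩, rfl⟩
  refine ⟨toLex (ofLex n + single i 1), ⟨?_, ?_⟩, (hmul (ofLex n)).symm⟩
  · rw [mem_degreeMonomials] at hn ⊢
    simpa using hn
  · rw [toLex_add, toLex_add]
    exact add_lt_add_left hlt _

/-- The monomials of `K[x_1, …, x_p]` as monomials in infinitely many variables. -/
noncomputable def extendExponents (p : ℕ) : (Fin p →₀ ℕ) ↪ (ℕ →₀ ℕ) :=
  ⟨Finsupp.mapDomain Fin.val, Finsupp.mapDomain_injective Fin.val_injective⟩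

theorem extendExponents_add_single (m : Fin p →₀ ℕ) (i : Fin p) :
    extendExponents p (m + single i 1) = extendExponents p m + single (i : ℕ) 1 := by
  simp [extendExponents, Finsupp.mapDomain_add]

theorem degree_extendExponents (m : Fin p →₀ ℕ) : (extendExponents p m).degree = m.degree :=
  Finsupp.degree_mapDomain _ _

theorem extendExponents_apply (m : Fin p →₀ ℕ) (i : Fin p) : extendExponents p m i = m i :=
  Finsupp.mapDomain_apply Fin.val_injective _ _

theorem extendExponents_apply_of_le (m : Fin p →₀ ℕ) {l : ℕ} (hl : p ≤ l) :
    extendExponents p m l = 0 :=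
  Finsupp.mapDomain_of_notMem_range _ _ (by rintro ⟨i, rfl⟩; omega)

theorem exists_extendExponents {m : ℕ →₀ ℕ} (h : ∀ l, p ≤ l → m l = 0) :
    ∃ n, extendExponents p n = m := by
  refine ⟨m.comapDomain Fin.val Fin.val_injective.injOn, ?_⟩
  ext l
  rcases lt_or_ge l p with hl | hl
  · exact extendExponents_apply _ ⟨l, hl⟩
  · rw [extendExponents_apply_of_le _ hl, h l hl]

/-- **Macaulay's theorem**, the upper bound. -/
theorem hilbertFunction_le_macaulayBound (I : Ideal (MvPolynomial (Fin p) K)) (t : ℕ) :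
    hilbertFunction I (t + 2) ≤ macaulayBound (t + 1) (hilbertFunction I (t + 1)) := by
  set e : Lex (Fin p →₀ ℕ) ↪ (ℕ →₀ ℕ) := ofLex.toEmbedding.trans (extendExponents p)
  rw [hilbertFunction_eq_card, hilbertFunction_eq_card, ← Finset.card_map e]
  refine (card_le_macaulayBound_shadow ?_).trans (macaulayBound_mono _ ?_)
  · intro m hm
    obtain ⟨n, hn, rfl⟩ := Finset.mem_map.1 hm
    exact (degree_extendExponents _).trans (mem_degreeMonomials.1 (mem_greedyBasis.1 hn).1)
  · rw [← Finset.card_map e]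
    -- The shadow of the standard monomials consists of standard monomials; the variable divided out
    -- has index below p because it occurs in one of them.
    refine Finset.card_le_card fun m hm => ?_
    obtain ⟨l, hl⟩ := mem_shadow.1 hm
    obtain ⟨n, hn, hnl⟩ := Finset.mem_map.1 hl
    have hnl : extendExponents p (ofLex n) = m + single l 1 := hnl
    have hlp : l < p := by
      by_contra hlp
      have := DFunLike.congr_fun hnl l
      rw [extendExponents_apply_of_le _ (by omega)] at this
      simp at this
    have hn0 : ofLex n ⟨l, hlp⟩ ≠ 0 := by
      have := DFunLike.congr_fun hnl l
      rw [show l = ((⟨l, hlp⟩ : Fin p) : ℕ) from rfl, extendExponents_apply] at this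
      rw [this]
      simp
    obtain ⟨n', hn'⟩ : ∃ n', ofLex n = n' + single ⟨l, hlp⟩ 1 :=
      ⟨ofLex n - single ⟨l, hlp⟩ 1, (tsub_add_cancel_of_le
        (by simpa [Nat.one_le_iff_ne_zero] using hn0)).symm⟩
    refine Finset.mem_map.2 ⟨toLex n', standardMonomials_of_add (i := ⟨l, hlp⟩) ?_, ?_⟩
    · rw [← hn']
      exact hn
    · rw [hn', extendExponents_add_single] at hnl
      exact add_right_cancel hnl

theorem hilbertFunction_zero_le_one (I : Ideal (MvPolynomial (Fin p) K)) :
    hilbertFunction I 0 ≤ 1 := by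
  rw [hilbertFunction_eq_card, Finset.card_le_one]
  intro a ha b hb
  have ha := mem_degreeMonomials.1 (mem_greedyBasis.1 ha).1
  have hb := mem_degreeMonomials.1 (mem_greedyBasis.1 hb).1
  rw [Finsupp.degree_eq_zero_iff] at ha hb
  exact ofLex.injective (ha.trans hb.symm)

theorem mem_of_add_mem_of_shadow_subset {N : ℕ → Finset (ℕ →₀ ℕ)}
    (hsh : ∀ t, shadow (N (t + 1)) ⊆ N t) (d : ℕ →₀ ℕ) {m : ℕ →₀ ℕ}
    (h : m + d ∈ N (m + d).degree) : m ∈ N m.degree := by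
  induction hd : d.degree generalizing d with
  | zero =>
    rw [Finsupp.degree_eq_zero_iff] at hd
    simpa [hd] using h
  | succ k ih =>
    have hd0 : d ≠ 0 := by
      rintro rfl
      simp at hd
    obtain ⟨j, hj⟩ := Finsupp.ne_iff.1 hd0
    obtain ⟨n, rfl⟩ := exists_eq_add_single hj
    rw [← add_assoc, map_add, Finsupp.degree_single] at h
    refine ih n (hsh _ (mem_shadow.2 ⟨j, h⟩)) (by simpa using hd)

/-- A system of sets of monomials closed under division gives a monomial ideal. -/
theorem exists_ideal_hilbertFunction_eq (K : Type*) [Field K] {N : ℕ → Finset (ℕ →₀ ℕ)}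
    (hdeg : ∀ t, ∀ m ∈ N t, m.degree = t) (hsh : ∀ t, shadow (N (t + 1)) ⊆ N t)
    (hp : ∀ t, ∀ m ∈ N t, ∀ l, p ≤ l → m l = 0) :
    ∃ I : Ideal (MvPolynomial (Fin p) K), I.IsHomogeneous (homogeneousSubmodule (Fin p) K) ∧
      ∀ t, hilbertFunction I t = (N t).card := by
  set S : Set (Fin p →₀ ℕ) := {n | extendExponents p n ∉ N n.degree} with hS
  set I : Ideal (MvPolynomial (Fin p) K) := Ideal.span ((fun s => monomial s (1 : K)) '' S) with hI
  refine ⟨I, Ideal.homogeneous_span _ _ ?_, fun t => ?_⟩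
  · rintro _ ⟨s, -, rfl⟩
    exact ⟨s.degree, isHomogeneous_monomial _ rfl⟩
  have hup : ∀ s ∈ S, ∀ n, s ≤ n → n ∈ S := by
    intro s hs n hsn hn
    obtain ⟨d, rfl⟩ := exists_add_of_le hsn
    have hadd : extendExponents p (s + d) = extendExponents p s + extendExponents p d := by
      simp [extendExponents, Finsupp.mapDomain_add]
    rw [← degree_extendExponents, hadd] at hn
    have := mem_of_add_mem_of_shadow_subset hsh _ hn
    rw [degree_extendExponents] at this
    exact hs this
  have hmem : ∀ m, m ∈ standardMonomials I t ↔
      extendExponents p (ofLex m) ∈ N t := by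
    intro m
    rw [standardMonomials, mem_greedyBasis, mem_degreeMonomials]
    constructor
    · rintro ⟨rfl, h⟩
      by_contra hm
      refine h ?_
      have : monomialClass I m = 0 :=
        Ideal.Quotient.eq_zero_iff_mem.2 (Ideal.subset_span ⟨_, hm, rfl⟩)
      rw [this]
      exact Submodule.zero_mem _
    · intro hm
      have hd : (ofLex m).degree = t := by
        rw [← degree_extendExponents]
        exact hdeg t _ hm
      refine ⟨hd, fun h => ?_⟩
      -- A combination f of other monomials has no m-term, so m occurs in m - f ∈ I and is divisible
      -- by a generator; being a multiple, it would itself lie outside N.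
      set A : Set (Lex (Fin p →₀ ℕ)) := {j | j ∈ degreeMonomials p t ∧ j < m}
      have himg : monomialClass I '' A =
          (Ideal.Quotient.mkₐ K I).toLinearMap '' ((fun n => monomial (ofLex n) (1 : K)) '' A) := by
        rw [← Set.image_comp]
        rfl
      rw [himg, ← Submodule.map_span] at h
      obtain ⟨f, hf, hfm⟩ := h
      have hle : Submodule.span K ((fun n => monomial (ofLex n) (1 : K)) '' A) ≤
          LinearMap.ker (lcoeff K (ofLex m)) := by
        rw [Submodule.span_le]
        rintro _ ⟨n, ⟨-, hn⟩, rfl⟩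
        have : ofLex n ≠ ofLex m := fun h => hn.ne (ofLex.injective h)
        simp [lcoeff_apply, coeff_monomial, this]
      have hcoeff : coeff (ofLex m) f = 0 := hle hf
      have hmemI : monomial (ofLex m) (1 : K) - f ∈ I := Ideal.Quotient.eq.1 hfm.symm
      obtain ⟨s, hs, hsm⟩ := mem_ideal_span_monomial_image.1 hmemI (ofLex m)
        (by simp [mem_support_iff, hcoeff])
      refine hup s hs _ hsm ?_
      rwa [hd]
  rw [hilbertFunction_eq_card, ← Finset.card_map (ofLex.toEmbedding.trans (extendExponents p))]
  congr 1
  ext m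
  simp only [Finset.mem_map, hmem]
  constructor
  · rintro ⟨n, hn, rfl⟩
    exact hn
  · intro hm
    obtain ⟨n, rfl⟩ := exists_extendExponents (hp t m hm)
    exact ⟨toLex n, hm, rfl⟩

end OSeq

/-! ### Macaulay's theorem and finite O-sequences as lists -/

namespace OSeq

attribute [local instance] MvPolynomial.gradedAlgebra

open MvPolynomial

theorem hilbertFunction_succ_eq_zero {K : Type*} [Field K] {p t : ℕ}
    {I : Ideal (MvPolynomial (Fin p) K)} (h : hilbertFunction I t = 0) :
    hilbertFunction I (t + 1) = 0 := by
  rw [hilbertFunction_eq_card, Finset.card_eq_zero] at h ⊢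
  refine Finset.eq_empty_of_forall_notMem fun m hm => ?_
  have hd := mem_degreeMonomials.1 (mem_greedyBasis.1 hm).1
  have hm0 : ofLex m ≠ 0 := by
    intro h0
    simp [h0] at hd
  obtain ⟨i, hi⟩ := Finsupp.ne_iff.1 hm0
  have hle : Finsupp.single i 1 ≤ ofLex m := by
    simpa [Nat.one_le_iff_ne_zero] using hi
  have := standardMonomials_of_add (I := I) (t := t) (m := ofLex m - Finsupp.single i 1) (i := i)
    (by rw [tsub_add_cancel_of_le hle]; exact hm)
  rw [h] at this
  simp at this

/-- **Macaulay's theorem** for functions with finite support. -/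
theorem isOSequence_iff {K : Type*} [Field K] {H : ℕ → ℕ} {s : ℕ} (hs : ∀ t, s ≤ t → H t = 0)
    (hne : ∃ t, H t ≠ 0) :
    IsOSequence K H ↔ H 0 = 1 ∧ ∀ t, H (t + 2) ≤ macaulayBound (t + 1) (H (t + 1)) := by
  constructor
  · rintro ⟨p, I, -, rfl⟩
    refine ⟨le_antisymm (hilbertFunction_zero_le_one I) ?_, hilbertFunction_le_macaulayBound I⟩
    by_contra h0
    obtain ⟨t, ht⟩ := hne
    refine ht ?_
    clear ht
    induction t with
    | zero => omega
    | succ t ih => exact hilbertFunction_succ_eq_zero ih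
  · rintro ⟨h0, hM⟩
    -- As H vanishes from s on, finitely many monomials are involved; the largest variable index
    -- among them determines the number of variables.
    set U := (Finset.range s).biUnion fun t => segment t (H t) with hU
    have hsh : ∀ t, shadow (segment (t + 1) (H (t + 1))) ⊆ segment t (H t) := by
      -- Between degrees 0 and 1 there is no bound: the only divisor is the monomial 1, present
      -- because H(0) = 1.
      rintro (_ | t)
      · intro m hm
        obtain ⟨l, hl⟩ := mem_shadow.1 hm
        have := degree_of_mem_segment hl
        simp only [map_add, Finsupp.degree_single, Nat.add_eq_right, Finsupp.degree_eq_zero_iff]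
          at this
        simp [segment, h0, this]
      · exact shadow_segment_subset (hM t)
    have hp : ∀ t, ∀ m ∈ segment t (H t), ∀ l, U.sup (fun m => m.support.sup id) + 1 ≤ l →
        m l = 0 := by
      intro t m hm l hl
      by_contra hml
      have hts : t < s := by
        by_contra hts
        rw [hs t (by omega), segment_zero_right] at hm
        simp at hm
      have h1 : m.support.sup id ≤ U.sup (fun m => m.support.sup id) :=
        Finset.le_sup (f := fun m : ℕ →₀ ℕ => m.support.sup id)
          (Finset.mem_biUnion.2 ⟨t, Finset.mem_range.2 hts, hm⟩)
      have h2 : l ≤ m.support.sup id :=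
        Finset.le_sup (f := id) (Finsupp.mem_support_iff.2 hml)
      omega
    obtain ⟨I, hI, hH⟩ := exists_ideal_hilbertFunction_eq K
      (fun t m hm => degree_of_mem_segment hm) hsh hp
    refine ⟨_, I, hI, ?_⟩
    ext t
    rw [hH, card_segment]
    rintro rfl
    exact h0.le

theorem getLastD_eq_getD (l : List ℕ) : l.getLastD 0 = l.getD (l.length - 1) 0 := by
  rcases l.eq_nil_or_concat with rfl | ⟨l, x, rfl⟩ <;> simp

theorem isFiniteOSequence_iff {K : Type*} [Field K] {l : List ℕ} :
    IsFiniteOSequence K l ↔ l.getD 0 0 = 1 ∧ l.getLastD 0 ≠ 0 ∧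
      ∀ t, l.getD (t + 2) 0 ≤ macaulayBound (t + 1) (l.getD (t + 1) 0) := by
  have hlast := getLastD_eq_getD l
  rw [IsFiniteOSequence]
  constructor
  · rintro ⟨-, h2, h3⟩
    have := (isOSequence_iff (s := l.length) (fun t ht => by simp [ht])
      ⟨_, hlast ▸ h2⟩).1 h3
    exact ⟨this.1, h2, this.2⟩
  · rintro ⟨h1, h2, h3⟩
    refine ⟨?_, h2, (isOSequence_iff (s := l.length) (fun t ht => by simp [ht])
      ⟨_, hlast ▸ h2⟩).2 ⟨h1, h3⟩⟩
    rintro rfl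
    simp at h1

variable {K : Type*} [Field K]

theorem isFiniteOSequence_singleton {x : ℕ} : IsFiniteOSequence K [x] ↔ x = 1 := by
  rw [isFiniteOSequence_iff]
  constructor
  · rintro ⟨h, -⟩
    simpa using h
  · rintro rfl
    simp

theorem getD_concat (l : List ℕ) (x t : ℕ) :
    (l ++ [x]).getD t 0 = if t < l.length then l.getD t 0 else if t = l.length then x else 0 := by
  split_ifs with h1 h2
  · rw [List.getD_append _ _ _ _ h1]
  · rw [List.getD_append_right _ _ _ _ (by omega), h2]
    simp
  · rw [List.getD_eq_default]
    simp
    omega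

theorem isFiniteOSequence_concat {l : List ℕ} (hl : l ≠ []) {x : ℕ} :
    IsFiniteOSequence K (l ++ [x]) ↔ IsFiniteOSequence K l ∧ x ≠ 0 ∧
      (2 ≤ l.length → x ≤ macaulayBound (l.length - 1) (l.getLastD 0)) := by
  have hlen := List.length_pos_iff.2 hl
  rw [isFiniteOSequence_iff, isFiniteOSequence_iff, getLastD_eq_getD l, getD_concat, if_pos hlen]
  simp only [List.getLastD_concat, getD_concat]
  constructor
  · rintro ⟨h0, hx, hM⟩
    have hMx : 2 ≤ l.length → x ≤ macaulayBound (l.length - 1) (l.getD (l.length - 1) 0) := by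
      intro h2
      obtain ⟨n, hn⟩ := Nat.exists_eq_add_of_le' h2
      have := hM n
      rw [if_neg (by omega), if_pos hn.symm, if_pos (by omega)] at this
      rwa [hn]
    refine ⟨⟨h0, fun h => ?_, fun t => ?_⟩, hx, hMx⟩
    -- The last value of l is 1 if l has length one; otherwise a last value 0 would force x = 0,
    -- since 0^⟨t⟩ = 0.
    · rcases (show 1 ≤ l.length by omega).eq_or_lt with h1 | h2
      · rw [← h1] at h
        exact one_ne_zero (h0.symm.trans h)
      · have := hMx h2
        rw [h, macaulayBound_zero_right] at this
        exact hx (Nat.le_zero.1 this)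
    · by_cases ht : t + 2 < l.length
      · have := hM t
        rwa [if_pos ht, if_pos (by omega)] at this
      · rw [List.getD_eq_default _ _ (by omega)]
        exact Nat.zero_le _
  · rintro ⟨⟨h0, hl0, hM⟩, hx, hMx⟩
    refine ⟨h0, hx, fun t => ?_⟩
    rcases lt_trichotomy (t + 2) l.length with h | h | h
    · rw [if_pos h, if_pos (by omega)]
      exact hM t
    · rw [if_neg (by omega), if_pos h, if_pos (by omega)]
      have := hMx (by omega)
      rwa [show l.length - 1 = t + 1 by omega] at this
    · rw [if_neg (by omega), if_neg (by omega)]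
      exact Nat.zero_le _

theorem macaulayBound_one (t : ℕ) : macaulayBound (t + 1) 1 = 1 := by
  have h := macaulayBound_choose_add (t := t) (k := t + 1) (r := 0) (by omega)
    (Nat.choose_pos (by omega))
  simpa [macaulayBound_zero_right] using h

theorem le_macaulayBound (t a : ℕ) : a ≤ macaulayBound (t + 1) a :=
  (macaulayBound_strictMono t).le_apply

theorem IsFiniteOSequence.sum_pos {l : List ℕ} (h : IsFiniteOSequence K l) : 1 ≤ l.sum := by
  have h2 := h.2.1
  rcases l.eq_nil_or_concat with rfl | ⟨l, x, rfl⟩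
  · simp at h2
  · simp at h2 ⊢
    omega

theorem IsFiniteOSequence.eq_of_sum_eq_one {l : List ℕ} (h : IsFiniteOSequence K l)
    (hs : l.sum = 1) : l = [1] := by
  rcases l.eq_nil_or_concat with rfl | ⟨l, x, rfl⟩
  · simp at hs
  by_cases hl : l = []
  · subst hl
    simpa using hs
  · rw [List.concat_eq_append, isFiniteOSequence_concat hl] at h
    have := h.1.sum_pos
    simp at hs
    omega

theorem exists_concat_of_mem_bigLast {d : ℕ} {l : List ℕ} (h : l ∈ bigLastOSequences K d) :
    ∃ l₀ x, l₀ ≠ [] ∧ 1 < x ∧ l = l₀ ++ [x] ∧ l₀.sum + x = d ∧ IsFiniteOSequence K l₀ ∧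
      (2 ≤ l₀.length → x ≤ macaulayBound (l₀.length - 1) (l₀.getLastD 0)) := by
  obtain ⟨⟨h1, h2⟩, h3⟩ := h
  rcases l.eq_nil_or_concat with rfl | ⟨l, x, rfl⟩
  · simp at h3
  rw [List.concat_eq_append] at *
  simp only [List.getLastD_concat, List.sum_append, List.sum_singleton] at h2 h3
  by_cases hl : l = []
  · subst hl
    rw [List.nil_append, isFiniteOSequence_singleton] at h1
    omega
  · rw [isFiniteOSequence_concat hl] at h1
    exact ⟨l, x, hl, h3, rfl, h2, h1.1, h1.2.2⟩

theorem concat_mem_bigLast_iff {d x : ℕ} {l : List ℕ} (hl : l ≠ []) :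
    l ++ [x] ∈ bigLastOSequences K d ↔ 1 < x ∧ l.sum + x = d ∧ IsFiniteOSequence K l ∧
      (2 ≤ l.length → x ≤ macaulayBound (l.length - 1) (l.getLastD 0)) := by
  simp only [bigLastOSequences, finiteOSequences, Set.mem_ofPred_eq, isFiniteOSequence_concat hl,
    List.getLastD_concat, List.sum_append, List.sum_singleton]
  constructor
  · rintro ⟨⟨⟨h1, -, h2⟩, h3⟩, h4⟩
    exact ⟨h4, h3, h1, h2⟩
  · rintro ⟨h4, h3, h1, h2⟩
    exact ⟨⟨⟨h1, by omega, h2⟩, h3⟩, h4⟩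

theorem incrementLast_concat (l : List ℕ) (x : ℕ) : incrementLast (l ++ [x]) = l ++ [x + 1] := by
  simp [incrementLast]

theorem canIncrementLast_concat {l : List ℕ} (hl : l ≠ []) (x : ℕ) :
    canIncrementLast (l ++ [x]) = true ↔
      (2 ≤ l.length → x + 1 ≤ macaulayBound (l.length - 1) (l.getLastD 0)) := by
  have hlen := List.length_pos_iff.2 hl
  rw [canIncrementLast]
  simp only [List.length_append, List.length_singleton, Nat.add_sub_cancel, getD_concat,
    lt_irrefl, if_true, if_false, Nat.sub_lt hlen zero_lt_one, getLastD_eq_getD]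
  rw [if_neg (by omega)]
  split_ifs with h1
  · simp [h1]
  · rw [decide_eq_true_iff]
    exact ⟨fun h _ => h, fun h => h (by omega)⟩

/-- A last value 2 cannot follow a 1 in positive degree because 1^⟨t⟩ = 1, and it can follow any
larger value because a ≤ a^⟨t⟩. The condition on d excludes (1, 2), whose truncation (1) ends in 1.
-/
theorem mem_bigLastOSequences_add_two {d : ℕ} (hd : 2 ≤ d) {l : List ℕ} :
    l ∈ bigLastOSequences K (d + 2) ↔ (∃ l' ∈ bigLastOSequences K d, attachTwo l' = l) ∨
      ∃ l', (l' ∈ bigLastOSequences K (d + 1) ∧ canIncrementLast l' = true) ∧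
        incrementLast l' = l := by
  constructor
  · intro h
    obtain ⟨l, x, hl, hx, rfl, hs, hO, hM⟩ := exists_concat_of_mem_bigLast h
    rcases (show 2 ≤ x from hx).eq_or_lt with rfl | hx
    · left
      refine ⟨l, ⟨⟨hO, by omega⟩, ?_⟩, rfl⟩
      rcases (show 1 ≤ l.length from List.length_pos_iff.2 hl).eq_or_lt with h1 | h2
      · obtain ⟨y, rfl⟩ := List.length_eq_one_iff.1 h1.symm
        rw [isFiniteOSequence_singleton] at hO
        simp [hO] at hs
        omega
      · have h3 := hM h2
        obtain ⟨n, hn⟩ := Nat.exists_eq_add_of_le' (show 2 ≤ l.length from h2)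
        by_contra h4
        rw [show l.getLastD 0 = 1 by have := hO.2.1; omega, hn, Nat.add_sub_assoc (by omega),
          macaulayBound_one] at h3
        omega
    · right
      obtain ⟨x, rfl⟩ : ∃ y, x = y + 1 := ⟨x - 1, by omega⟩
      refine ⟨l ++ [x], ⟨?_, ?_⟩, incrementLast_concat l x⟩
      · rw [concat_mem_bigLast_iff hl]
        exact ⟨by omega, by omega, hO, fun h => (Nat.le_succ x).trans (hM h)⟩
      · rwa [canIncrementLast_concat hl]
  · rintro (⟨l, hl, rfl⟩ | ⟨l, ⟨hl, hc⟩, rfl⟩)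
    · obtain ⟨⟨hO, hs⟩, hx⟩ := hl
      rw [attachTwo, concat_mem_bigLast_iff hO.1]
      refine ⟨one_lt_two, by omega, hO, fun h => ?_⟩
      obtain ⟨n, hn⟩ := Nat.exists_eq_add_of_le' h
      rw [hn]
      exact (show 2 ≤ l.getLastD 0 from hx).trans (le_macaulayBound n _)
    · obtain ⟨l, x, hne, hx, rfl, hs, hO, -⟩ := exists_concat_of_mem_bigLast hl
      rw [canIncrementLast_concat hne] at hc
      rw [incrementLast_concat, concat_mem_bigLast_iff hne]
      exact ⟨by omega, by omega, hO, hc⟩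

/-! ### The recursions and the correctness of the loop -/

/-- `B` lists without repetition the O-sequences of multiplicity `d` with last value `> 1`. -/
def Enumerates (K : Type*) [Field K] (B : List (List ℕ)) (d : ℕ) : Prop :=
  B.Nodup ∧ ∀ l, l ∈ B ↔ l ∈ bigLastOSequences K d

/-- The list of sequences computed in one pass of the loop. -/
def nextList (B₂ B₁ : List (List ℕ)) : List (List ℕ) :=
  B₂.map attachTwo ++ (B₁.filter canIncrementLast).map incrementLast

theorem Enumerates.next {d : ℕ} (hd : 2 ≤ d) {B₂ B₁ : List (List ℕ)} (h₂ : Enumerates K B₂ d)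
    (h₁ : Enumerates K B₁ (d + 1)) : Enumerates K (nextList B₂ B₁) (d + 2) := by
  refine ⟨?_, fun l => ?_⟩
  · rw [nextList, List.nodup_append']
    refine ⟨h₂.1.map (List.append_left_injective [2]), ?_, ?_⟩
    · refine List.Nodup.map_on ?_ (h₁.1.filter _)
      intro a ha b hb hab
      obtain ⟨a, x, -, -, rfl, -⟩ := exists_concat_of_mem_bigLast
        ((h₁.2 a).1 (List.mem_filter.1 ha).1)
      obtain ⟨b, y, -, -, rfl, -⟩ := exists_concat_of_mem_bigLast
        ((h₁.2 b).1 (List.mem_filter.1 hb).1)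
      rw [incrementLast_concat, incrementLast_concat] at hab
      have := List.append_inj' hab rfl
      simpa using this
    -- The two kinds of new sequences are disjoint: one ends in 2, the other in at least 3.
    · intro l hl hl'
      obtain ⟨a, -, rfl⟩ := List.mem_map.1 hl
      obtain ⟨b, hb, hab⟩ := List.mem_map.1 hl'
      obtain ⟨b, y, -, hy, rfl, -⟩ := exists_concat_of_mem_bigLast
        ((h₁.2 b).1 (List.mem_filter.1 hb).1)
      rw [incrementLast_concat, attachTwo] at hab
      have := (List.append_inj' hab rfl).2
      simp at this
      omega
  · rw [mem_bigLastOSequences_add_two hd, nextList, List.mem_append, List.mem_map, List.mem_map]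
    simp only [List.mem_filter, h₂.2, h₁.2]

theorem bigLastOSequences_eq_empty {d : ℕ} (hd : d ≤ 2) : bigLastOSequences K d = ∅ := by
  refine Set.eq_empty_of_forall_notMem fun l hl => ?_
  obtain ⟨l, x, hl, hx, rfl, hs, hO, -⟩ := exists_concat_of_mem_bigLast hl
  have := hO.sum_pos
  omega

theorem enumerates_nil {d : ℕ} (hd : d ≤ 2) : Enumerates K [] d :=
  ⟨List.nodup_nil, fun l => by simp [bigLastOSequences_eq_empty hd]⟩

theorem enumerates_three : Enumerates K [[1, 2]] 3 := by
  refine ⟨List.nodup_singleton _, fun l => ?_⟩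
  rw [List.mem_singleton]
  constructor
  · rintro rfl
    rw [show [1, 2] = [1] ++ [2] from rfl, concat_mem_bigLast_iff (by simp)]
    simp [isFiniteOSequence_singleton]
  · intro hl
    obtain ⟨l, x, hl, hx, rfl, hs, hO, -⟩ := exists_concat_of_mem_bigLast hl
    have := hO.sum_pos
    rw [hO.eq_of_sum_eq_one (by omega), show x = 2 by omega]
    rfl

theorem enumerates_four : Enumerates K [[1, 3]] 4 := by
  have : [[1, 3]] = nextList [] [[1, 2]] := rfl
  rw [this]
  exact (enumerates_nil le_rfl).next le_rfl enumerates_three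

theorem Enumerates.bigLastOSequences_eq {B : List (List ℕ)} {d : ℕ} (h : Enumerates K B d) :
    bigLastOSequences K d = (B.toFinset : Set (List ℕ)) := by
  ext l
  rw [← h.2]
  simp

theorem Enumerates.numA_eq {B : List (List ℕ)} {d : ℕ} (h : Enumerates K B d) :
    numA K d = B.length := by
  rw [numA, h.bigLastOSequences_eq, Set.ncard_coe_finset, List.toFinset_card_of_nodup h.1]

theorem exists_enumerates (d : ℕ) : ∃ B, Enumerates K B d := by
  induction d using Nat.strong_induction_on with
  | _ d ih =>
    rcases lt_or_ge d 4 with hd | hd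
    · rcases (show d ≤ 2 ∨ d = 3 by omega) with h | rfl
      · exact ⟨_, enumerates_nil h⟩
      · exact ⟨_, enumerates_three⟩
    · obtain ⟨d, rfl⟩ := Nat.exists_eq_add_of_le' (show 2 ≤ d by omega)
      obtain ⟨B₂, h₂⟩ := ih d (by omega)
      obtain ⟨B₁, h₁⟩ := ih (d + 1) (by omega)
      exact ⟨_, h₂.next (by omega) h₁⟩

theorem finite_bigLastOSequences (d : ℕ) : (bigLastOSequences K d).Finite := by
  obtain ⟨B, hB⟩ := exists_enumerates (K := K) d
  rw [hB.bigLastOSequences_eq]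
  exact Finset.finite_toSet _

theorem finiteOSequences_one : finiteOSequences K 1 = {[1]} := by
  ext l
  constructor
  · rintro ⟨h1, h2⟩
    exact h1.eq_of_sum_eq_one h2
  · rintro rfl
    exact ⟨isFiniteOSequence_singleton.2 rfl, rfl⟩

theorem isFiniteOSequence_concat_one {l : List ℕ} (hl : l ≠ []) :
    IsFiniteOSequence K (l ++ [1]) ↔ IsFiniteOSequence K l := by
  rw [isFiniteOSequence_concat hl]
  refine ⟨fun h => h.1, fun h => ⟨h, one_ne_zero, fun h2 => ?_⟩⟩
  obtain ⟨n, hn⟩ := Nat.exists_eq_add_of_le' h2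
  rw [hn]
  exact (Nat.one_le_iff_ne_zero.2 h.2.1).trans (le_macaulayBound n _)

/-- A last value 1 can be removed, and can be appended to any finite O-sequence. For d = 0 the
sequence (1) would have no truncation. -/
theorem finiteOSequences_succ {d : ℕ} (hd : 1 ≤ d) :
    finiteOSequences K (d + 1) =
      bigLastOSequences K (d + 1) ∪ (· ++ [1]) '' finiteOSequences K d := by
  ext l
  constructor
  · intro hO
    by_cases h1 : 1 < l.getLastD 0
    · exact Or.inl ⟨hO, h1⟩
    right
    obtain ⟨hO, hs⟩ := hO
    have h0 := hO.2.1
    rcases l.eq_nil_or_concat with rfl | ⟨l, x, rfl⟩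
    · simp at h0
    simp only [List.concat_eq_append, List.getLastD_concat, List.sum_append, List.sum_singleton]
      at *
    obtain rfl : x = 1 := by omega
    have hl : l ≠ [] := by
      rintro rfl
      simp at hs
      omega
    exact ⟨l, ⟨(isFiniteOSequence_concat_one hl).1 hO, by omega⟩, rfl⟩
  · rintro (h | ⟨l, ⟨hO, hs⟩, rfl⟩)
    · exact h.1
    · exact ⟨(isFiniteOSequence_concat_one hO.1).2 hO, by simp [hs]⟩

theorem finite_finiteOSequences {d : ℕ} (hd : 1 ≤ d) : (finiteOSequences K d).Finite := by
  induction d, hd using Nat.le_induction with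
  | base =>
    rw [finiteOSequences_one]
    exact Set.finite_singleton _
  | succ d hd ih =>
    rw [finiteOSequences_succ hd]
    exact (finite_bigLastOSequences _).union (ih.image _)

theorem numO_one : numO K 1 = 1 := by
  rw [numO, finiteOSequences_one, Set.ncard_singleton]

theorem numO_succ {d : ℕ} (hd : 1 ≤ d) : numO K (d + 1) = numA K (d + 1) + numO K d := by
  rw [numO, finiteOSequences_succ hd, Set.ncard_union_eq _ (finite_bigLastOSequences _)
    ((finite_finiteOSequences hd).image _),
    Set.ncard_image_of_injective _ (List.append_left_injective [1])]
  · rfl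
  · rw [Set.disjoint_left]
    rintro _ ⟨-, h⟩ ⟨l, -, rfl⟩
    simp at h

/-- The loop invariant: the state after the pass for `d` is correct. -/
structure IsCorrect (K : Type*) [Field K] (S : AlgState) (d : ℕ) : Prop where
  O_eq : S.O = (List.range' 1 d).map (numO K)
  A_eq : S.A = (List.range' 1 d).map (numA K)
  enum₁ : Enumerates K (S.B S.h₁) d
  enum₂ : Enumerates K (S.B S.h₂) (d - 1)
  ne₂₁ : S.h₂ ≠ S.h₁
  ne₁ : S.h₁ ≠ S.h
  ne₂ : S.h₂ ≠ S.h

theorem isCorrect_initState : IsCorrect K initState 4 where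
  O_eq := by
    have h2 := numO_succ (K := K) (d := 1) le_rfl
    have h3 := numO_succ (K := K) (d := 2) (by omega)
    have h4 := numO_succ (K := K) (d := 3) (by omega)
    rw [(enumerates_nil le_rfl).numA_eq, numO_one] at h2
    rw [enumerates_three.numA_eq, h2] at h3
    rw [enumerates_four.numA_eq, h3] at h4
    simp [initState, List.range', numO_one, h2, h3, h4]
  A_eq := by
    have h1 := (enumerates_nil (K := K) one_le_two).numA_eq
    have h2 := (enumerates_nil (K := K) le_rfl).numA_eq
    have h3 := (enumerates_three (K := K)).numA_eq
    have h4 := (enumerates_four (K := K)).numA_eq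
    simp [initState, List.range', h1, h2, h3, h4]
  enum₁ := enumerates_four
  enum₂ := enumerates_three
  ne₂₁ := by decide
  ne₁ := by decide
  ne₂ := by decide

theorem IsCorrect.loopBody {S : AlgState} {d : ℕ} (hd : 4 ≤ d) (h : IsCorrect K S d) :
    IsCorrect K (loopBody S (d + 1)) (d + 1) := by
  have henum : Enumerates K (nextList (S.B S.h₂) (S.B S.h₁)) (d + 1) := by
    obtain ⟨d, rfl⟩ := Nat.exists_eq_add_of_le' (show 1 ≤ d by omega)
    exact Enumerates.next (by omega) h.enum₂ h.enum₁
  have hA : S.A ++ [(nextList (S.B S.h₂) (S.B S.h₁)).length] =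
      (List.range' 1 (d + 1)).map (numA K) := by
    rw [List.range'_concat, List.map_append, h.A_eq, ← henum.numA_eq, one_mul, add_comm 1 d]
    rfl
  refine ⟨?_, hA, ?_, ?_, h.ne₁, h.ne₂.symm, h.ne₂₁.symm⟩
  · change S.O ++ [(S.A ++ [(nextList (S.B S.h₂) (S.B S.h₁)).length]).getD (d + 1 - 1) 0 +
      S.O.getD (d + 1 - 2) 0] = _
    -- Both positions read from the lists are in range, so the default 0 of `getD` never enters.
    have h1 : ((List.range' 1 (d + 1)).map (numA K)).getD (d + 1 - 1) 0 = numA K (d + 1) := by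
      simp [List.getD_eq_getElem?_getD, add_comm]
    have h2 : ((List.range' 1 d).map (numO K)).getD (d + 1 - 2) 0 = numO K d := by
      rw [List.getD_eq_getElem?_getD, List.getElem?_map, List.getElem?_range' (by omega)]
      simp only [Option.map_some, Option.getD_some]
      congr 1
      omega
    rw [hA, h.O_eq, h1, h2, ← numO_succ (by omega), List.range'_concat, List.map_append, one_mul,
      add_comm 1 d]
    rfl
  · change Enumerates K (Function.update S.B S.h _ S.h) _
    rw [Function.update_self]
    exact henum
  -- The old slot h₁, now h₂, survives because the new list is written to a different slot.
  · change Enumerates K (Function.update S.B S.h _ S.h₁) _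
    rw [Function.update_of_ne h.ne₁]
    exact h.enum₁

theorem isCorrect_finalState {D : ℕ} (hD : 4 ≤ D) : IsCorrect K (finalState D) D := by
  induction D, hD using Nat.le_induction with
  | base => exact isCorrect_initState
  | succ D hD ih =>
    have : finalState (D + 1) = OSeq.loopBody (finalState D) (D + 1) := by
      rw [finalState, Nat.sub_add_comm hD, List.range'_concat, List.foldl_append, ← finalState,
        show 5 + 1 * (D - 4) = D + 1 by omega]
      rfl
    rw [this]
    exact ih.loopBody hD

end OSeq

theorem proposition3p1 (K : Type*) [Field K] (D : ℕ) (hD : 4 ≤ D) :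
    -- the sets counted by `O_1, …, O_D` are finite
    (∀ d, 1 ≤ d → d ≤ D → (OSeq.finiteOSequences K d).Finite) ∧
    -- the output is `[O_1, …, O_D]`
    OSeq.algorithm D = (List.range' 1 D).map (OSeq.numO K) ∧
    -- the list `A` is `[A_1, …, A_D]`
    (OSeq.finalState D).A = (List.range' 1 D).map (OSeq.numA K) ∧
    -- the stored lists are, without repetition, the O-sequences of multiplicity `D` and `D - 1`
    -- with last value greater than `1` (the indices have just been shifted)
    ((OSeq.finalState D).B (OSeq.finalState D).h₁).Nodup ∧
    (∀ l : List ℕ, l ∈ (OSeq.finalState D).B (OSeq.finalState D).h₁ ↔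
      l ∈ OSeq.bigLastOSequences K D) ∧
    ((OSeq.finalState D).B (OSeq.finalState D).h₂).Nodup ∧
    (∀ l : List ℕ, l ∈ (OSeq.finalState D).B (OSeq.finalState D).h₂ ↔
      l ∈ OSeq.bigLastOSequences K (D - 1)) := by
  have h := OSeq.isCorrect_finalState (K := K) hD
  exact ⟨fun d hd _ => OSeq.finite_finiteOSequences hd, h.O_eq, h.A_eq, h.enum₁.1, h.enum₁.2,
    h.enum₂.1, h.enum₂.2⟩
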